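/- Let $d,L\ge 1$ be integers, $\Gamma:=\mathbb Z^d/(L\mathbb Z)^d$, $\Gamma^*:=(\tfrac{2\pi}{L}\mathbb Z)^d/(2\pi\mathbb Z)^d$, let $t,t',\mu\in\mathbb R$ and $\beta>0$. Let $\mathbf e_j\in\Gamma$ be the $j$-th unit vector, and let $\langle\mathbf k,\mathbf x\rangle=\sum_l \mathbf k(l)\mathbf x(l)$. On the Fermionic Fock space $F_f=\bigoplus_{n=0}^{2L^d}A_n\big(L^2((\Gamma\times\{\uparrow,\downarrow\})^n;\mathbb C)\big)$ ($A_n$ the anti-symmetrization, inner product the sum of those of $L^2((\Gamma\times\{\uparrow,\downarrow\})^n;\mathbb C)$), let $\psi_{\mathbf x\sigma}$ be the annihilation operators, $(\psi_{\mathbf x\sigma}\phi)(\mathbf x_1\sigma_1,\dots,\mathbf x_n\sigma_n)=\sqrt{n+1}\,\phi(\mathbf x\sigma,\mathbf x_1\sigma_1,\dots,\mathbf x_n\sigma_n)$ for an $(n+1)$-particle vector $\phi$, and $\psi_{\mathbf x\sigma}=0$ on the $0$-particle space; let $\psi^*_{\mathbf x\sigma}$ be the adjoint of $\psi_{\mathbf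 x\sigma}$. Put $$H_0:=\sum_{\mathbf x,\mathbf y\in\Gamma}\sum_{\sigma,\tau\in\{\uparrow,\downarrow\}}F(\mathbf x\sigma,\mathbf y\tau)\psi^*_{\mathbf x\sigma}\psi_{\mathbf y\tau},$$ $$F(\mathbf x\sigma,\mathbf y\tau):=\delta_{\sigma,\tau}\Big(-t\sum_{j=1}^d(\delta_{\mathbf x,\mathbf y-\mathbf e_j}+\delta_{\mathbf x,\mathbf y+\mathbf e_j})-t'\,1_{d\ge2}\sum_{1\le j<k\le d}(\delta_{\mathbf x,\mathbf y-\mathbf e_j-\mathbf e_k}+\delta_{\mathbf x,\mathbf y-\mathbf e_j+\mathbf e_k}+\delta_{\mathbf x,\mathbf y+\mathbf e_j-\mathbf e_k}+\delta_{\mathbf x,\mathbf y+\mathbf e_j+\mathbf e_k})-\mu\,\delta_{\mathbf x,\mathbf y}\Big).$$ For $U\in\mathbb R$ and real $\lambda_{\mathbf x,\mathbf y,\mathbf z,\mathbf w}$ ($\mathbf x,\mathbf y,\mathbf z,\mathbf w\in\Gamma$) put $U_{\mathbf x,\mathbf y,\mathbf z,\mathbf w}:=U\delta_{\mathbf x,\mathbf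 y}\delta_{\mathbf z,\mathbf w}\delta_{\mathbf x,\mathbf z}+\lambda_{\mathbf x,\mathbf y,\mathbf z,\mathbf w}+\lambda_{\mathbf z,\mathbf w,\mathbf x,\mathbf y}$ and $$H_\lambda:=H_0+\sum_{\mathbf x,\mathbf y,\mathbf z,\mathbf w\in\Gamma}U_{\mathbf x,\mathbf y,\mathbf z,\mathbf w}\,\psi^*_{\mathbf x\uparrow}\psi^*_{\mathbf y\downarrow}\psi_{\mathbf w\downarrow}\psi_{\mathbf z\uparrow}.$$ Define the dispersion relation and the covariance by $$E_{\mathbf k}:=-2t\sum_{j=1}^d\cos\langle\mathbf k,\mathbf e_j\rangle-4t'\,1_{d\ge2}\sum_{1\le j<k\le d}\cos\langle\mathbf k,\mathbf e_j\rangle\cos\langle\mathbf k,\mathbf e_k\rangle-\mu,$$ $$C(\mathbf x\sigma x,\mathbf y\tau y):=\frac{\delta_{\sigma,\tau}}{L^d}\sum_{\mathbf k\in\Gamma^*}e^{i\langle\mathbf k,\mathbf y-\mathbf x\rangle}e^{-(y-x)E_{\mathbf k}}\left(\frac{1_{y-x\le0}}{1+e^{\beta E_{\mathbf k}}}-\frac{1_{y-x>0}}{1+e^{-\beta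 E_{\mathbf k}}}\right).$$ Then for all $U\in\mathbb R$ and all real $\lambda$: $\mathrm{Tr}\,e^{-\beta H_0}\ne0$; for every $n$ and all choices of sites and spins the determinant below is an integrable function of $(x_1,x_3,\dots,x_{2n-1})\in[0,\beta]^n$; the series below converges absolutely; and $$\frac{\mathrm{Tr}\,e^{-\beta H_\lambda}}{\mathrm{Tr}\,e^{-\beta H_0}}=1+\sum_{n=1}^\infty\frac1{n!}\prod_{j=1}^n\Bigg(-\sum_{\mathbf x_{2j-1},\mathbf x_{2j},\mathbf y_{2j-1},\mathbf y_{2j}\in\Gamma}\ \sum_{\sigma_{2j-1},\sigma_{2j}\in\{\uparrow,\downarrow\}}\delta_{\sigma_{2j-1},\uparrow}\delta_{\sigma_{2j},\downarrow}\int_0^\beta dx_{2j-1}\,U_{\mathbf x_{2j-1},\mathbf x_{2j},\mathbf y_{2j-1},\mathbf y_{2j}}\Bigg)\det\big(C(\mathbf x_j\sigma_jx_j,\mathbf y_k\sigma_kx_k)\big)_{1\le j,k\le2n}\Big|_{x_{2j}=x_{2j-1}\ \forall j\in\{1,\dots,n\}},$$ where the product of sums and integrals acts on the determinant as a multiple sum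 and a multiple integral over $[0,\beta]^n$. -/

import Mathlib

open scoped BigOperators
open MeasureTheory

noncomputable section

namespace Hubbard

/-! ## The Fermionic Fock space over `L²(S; ℂ)` for a finite set `S` -/

section Fock

/-- The full (distinguishable particle) space `⨁_{n = 0}^{♯S} L²(Sⁿ; ℂ)`, with the inner product
`∑ₙ ∑_{x ∈ Sⁿ} conj (φ₁ x) * φ₂ x`. A vector `φ` has the `n`-particle wave function
`x ↦ φ ⟨n, x⟩`; for `n = 0` this is a single complex number. -/
abbrev FullFock (S : Type) [Fintype S] : Type :=
  EuclideanSpace ℂ (Σ n : Fin (Fintype.card S + 1), (Fin (n : ℕ) → S))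

/-- The anti-symmetrization operator `⨁ₙ Aₙ`, where
`(Aₙ φ)(x₁, …, xₙ) = (1 / n!) ∑_{π ∈ Sₙ} sgn π • φ(x_{π 1}, …, x_{π n})`. -/
def antisymmetrizer (S : Type) [Fintype S] : FullFock S →ₗ[ℂ] FullFock S where
  toFun φ := WithLp.toLp 2 fun p =>
    ((Nat.factorial (p.1 : ℕ) : ℕ) : ℂ)⁻¹ *
      ∑ π : Equiv.Perm (Fin (p.1 : ℕ)), ((Equiv.Perm.sign π : ℤ) : ℂ) * φ ⟨p.1, p.2 ∘ π⟩
  map_add' φ χ := by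
    ext p
    simp [mul_add, Finset.sum_add_distrib]
  map_smul' c φ := by
    ext p
    simp only [PiLp.smul_apply, smul_eq_mul, RingHom.id_apply, Finset.mul_sum]
    exact Finset.sum_congr rfl fun π _ => by ring

/-- The Fermionic Fock space `F_f(L²(S; ℂ)) = ⨁ₙ Aₙ(L²(Sⁿ; ℂ))`. -/
def fockSpace (S : Type) [Fintype S] : Submodule ℂ (FullFock S) :=
  LinearMap.range (antisymmetrizer S)

/-- The Fermionic Fock space as a (finite dimensional) Hilbert space. -/
def Fock (S : Type) [Fintype S] : Type := ↥(fockSpace S)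

instance (S : Type) [Fintype S] : NormedAddCommGroup (Fock S) :=
  inferInstanceAs (NormedAddCommGroup ↥(fockSpace S))

instance (S : Type) [Fintype S] : InnerProductSpace ℂ (Fock S) :=
  inferInstanceAs (InnerProductSpace ℂ ↥(fockSpace S))

instance (S : Type) [Fintype S] : FiniteDimensional ℂ (Fock S) :=
  inferInstanceAs (FiniteDimensional ℂ ↥(fockSpace S))

instance (S : Type) [Fintype S] : CompleteSpace (Fock S) :=
  FiniteDimensional.complete ℂ (Fock S)

/-- Linear operators on the Fock space, with composition as product and the operator norm. -/
abbrev Op (S : Type) [Fintype S] : Type := Fock S →L[ℂ] Fock S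

/-- The Fock space consists of the anti-symmetric wave functions. -/
theorem mem_fockSpace_iff {S : Type} [Fintype S] (φ : FullFock S) :
    φ ∈ fockSpace S ↔ ∀ (n : Fin (Fintype.card S + 1)) (x : Fin (n : ℕ) → S)
      (π : Equiv.Perm (Fin (n : ℕ))),
      φ ⟨n, x ∘ π⟩ = ((Equiv.Perm.sign π : ℤ) : ℂ) * φ ⟨n, x⟩ := by
  constructor
  · rintro ⟨χ, rfl⟩ n x π
    simp only [antisymmetrizer, LinearMap.coe_mk, AddHom.coe_mk]
    rw [mul_left_comm]
    congr 1
    rw [Finset.mul_sum]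
    refine Fintype.sum_equiv (Equiv.mulLeft π)
      (fun ρ : Equiv.Perm (Fin (n : ℕ)) =>
        ((Equiv.Perm.sign ρ : ℤ) : ℂ) * χ ⟨n, (x ∘ π) ∘ ρ⟩) _ fun ρ => ?_
    have h : ((Equiv.Perm.sign π : ℤ) : ℂ) * ((Equiv.Perm.sign π : ℤ) : ℂ) = 1 := by
      rw [← Int.cast_mul, ← Units.val_mul, Int.units_mul_self]; simp
    simp only [Equiv.coe_mulLeft, Equiv.Perm.sign_mul, Units.val_mul, Int.cast_mul,
      Equiv.Perm.coe_mul]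
    rw [← mul_assoc, ← mul_assoc, h, one_mul]
    rfl
  · intro h
    refine ⟨φ, ?_⟩
    ext ⟨n, x⟩
    simp only [antisymmetrizer, LinearMap.coe_mk, AddHom.coe_mk]
    have h2 : ∀ π : Equiv.Perm (Fin (n : ℕ)),
        ((Equiv.Perm.sign π : ℤ) : ℂ) * φ ⟨n, x ∘ π⟩ = φ ⟨n, x⟩ := by
      intro π
      rw [h n x π, ← mul_assoc, ← Int.cast_mul, ← Units.val_mul, Int.units_mul_self]
      simp
    rw [Finset.sum_congr rfl fun π _ => h2 π]
    simp [Fintype.card_perm, Nat.factorial_ne_zero]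

/-- `(ψ_s φ)(x₁, …, xₙ) = √(n+1) φ(s, x₁, …, xₙ)`, on all wave functions. The component with
`n = ♯S` is zero, because there are no anti-symmetric functions of `♯S + 1` variables in `S`. -/
def annihilateFull {S : Type} [Fintype S] (s : S) : FullFock S →ₗ[ℂ] FullFock S where
  toFun φ := WithLp.toLp 2 fun p =>
    if h : (p.1 : ℕ) + 1 < Fintype.card S + 1 then
      ((Real.sqrt ((p.1 : ℕ) + 1 : ℝ) : ℝ) : ℂ) *
        φ ⟨⟨(p.1 : ℕ) + 1, h⟩, (Fin.cons s p.2 : Fin ((p.1 : ℕ) + 1) → S)⟩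
    else 0
  map_add' φ χ := by
    ext p
    simp only [PiLp.add_apply]
    split_ifs
    · ring
    · simp
  map_smul' c φ := by
    ext p
    simp only [PiLp.smul_apply, smul_eq_mul, RingHom.id_apply]
    split_ifs
    · ring
    · simp

theorem annihilateFull_mem {S : Type} [Fintype S] (s : S) (φ : FullFock S)
    (hφ : φ ∈ fockSpace S) : annihilateFull s φ ∈ fockSpace S := by
  rw [mem_fockSpace_iff] at hφ ⊢
  intro n x π
  simp only [annihilateFull, LinearMap.coe_mk, AddHom.coe_mk]
  by_cases h : (n : ℕ) + 1 < Fintype.card S + 1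
  · simp only [h, dite_true]
    have key := hφ ⟨(n : ℕ) + 1, h⟩ (Fin.cons s x : Fin ((n : ℕ) + 1) → S)
      (Equiv.Perm.decomposeFin.symm (0, π))
    have hc : ((Fin.cons s x : Fin ((n : ℕ) + 1) → S) ∘
        (Equiv.Perm.decomposeFin.symm (0, π) : Equiv.Perm (Fin ((n : ℕ) + 1)))) =
        (Fin.cons s (x ∘ π) : Fin ((n : ℕ) + 1) → S) := by
      funext i
      refine Fin.cases ?_ (fun j => ?_) i <;> simp
    rw [hc, Equiv.Perm.decomposeFin.symm_sign, if_pos rfl, one_mul] at key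
    rw [key]
    ring
  · simp [h]

/-- The annihilation operator `ψ_s` on the Fock space. -/
def annihilate {S : Type} [Fintype S] (s : S) : Op S :=
  LinearMap.toContinuousLinearMap
    ((annihilateFull s).restrict fun φ hφ => annihilateFull_mem s φ hφ)

/-- The creation operator `ψ_s^*`, the adjoint of the annihilation operator. -/
def create {S : Type} [Fintype S] (s : S) : Op S :=
  ContinuousLinearMap.adjoint (annihilate s)

/-- The trace of an operator on the Fock space. -/
def Tr {S : Type} [Fintype S] (A : Op S) : ℂ :=
  LinearMap.trace ℂ (Fock S) (A : Fock S →ₗ[ℂ] Fock S)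

end Fock

/-! ## The Hubbard model -/

/-- The two spin values. -/
inductive Spin : Type
  | up : Spin
  | down : Spin
  deriving DecidableEq

instance : Fintype Spin where
  elems := {Spin.up, Spin.down}
  complete := fun x => by cases x <;> simp

/-- The lattice `Γ = ℤᵈ / (Lℤ)ᵈ`. -/
abbrev Lattice (d L : ℕ) : Type := Fin d → ZMod L

/-- Kronecker's delta. -/
def kron {X : Type} [DecidableEq X] (x y : X) : ℝ := if x = y then 1 else 0

/-- The lattice vectors `e_j`. -/
def unitVec {d L : ℕ} (j : Fin d) : Lattice d L := fun l => if j = l then 1 else 0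

/-- The hopping matrix `F(xσ, yτ)`. -/
def hopping {d L : ℕ} (t t' μ : ℝ) (X Y : Lattice d L × Spin) : ℝ :=
  kron X.2 Y.2 *
    (-t * (∑ j : Fin d,
        (kron X.1 (Y.1 - unitVec j) + kron X.1 (Y.1 + unitVec j)))
      - t' * (if 2 ≤ d then 1 else 0) * (∑ j : Fin d, ∑ k : Fin d, if j < k then
          (kron X.1 (Y.1 - unitVec j - unitVec k) + kron X.1 (Y.1 - unitVec j + unitVec k)
            + kron X.1 (Y.1 + unitVec j - unitVec k)
            + kron X.1 (Y.1 + unitVec j + unitVec k)) else 0)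
      - μ * kron X.1 Y.1)

/-- The free Hamiltonian `H₀ = ∑ F(xσ, yτ) ψ_{xσ}^* ψ_{yτ}`. -/
def freeHamiltonian (d L : ℕ) [NeZero L] (t t' μ : ℝ) :
    Op (Lattice d L × Spin) :=
  ∑ X : Lattice d L × Spin, ∑ Y : Lattice d L × Spin,
    ((hopping t t' μ X Y : ℝ) : ℂ) • (create X * annihilate Y)

/-- `U_{x,y,z,w} = U δ_{x,y} δ_{z,w} δ_{x,z} + λ_{x,y,z,w} + λ_{z,w,x,y}`. -/
def coupling {d L : ℕ} (U : ℝ)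
    (lam : Lattice d L → Lattice d L → Lattice d L → Lattice d L → ℝ)
    (x y z w : Lattice d L) : ℝ :=
  U * kron x y * kron z w * kron x z + lam x y z w + lam z w x y

/-- The interaction `V_λ = ∑ U_{x,y,z,w} ψ_{x↑}^* ψ_{y↓}^* ψ_{w↓} ψ_{z↑}`. -/
def interaction {d L : ℕ} [NeZero L] (U : ℝ)
    (lam : Lattice d L → Lattice d L → Lattice d L → Lattice d L → ℝ) :
    Op (Lattice d L × Spin) :=
  ∑ x : Lattice d L, ∑ y : Lattice d L, ∑ z : Lattice d L, ∑ w : Lattice d L,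
    ((coupling U lam x y z w : ℝ) : ℂ) •
      (create (x, Spin.up) * create (y, Spin.down) *
        annihilate (w, Spin.down) * annihilate (z, Spin.up))

/-- `H_λ = H₀ + V_λ`. -/
def hamiltonian {d L : ℕ} [NeZero L] (t t' μ U : ℝ)
    (lam : Lattice d L → Lattice d L → Lattice d L → Lattice d L → ℝ) :
    Op (Lattice d L × Spin) :=
  freeHamiltonian d L t t' μ + interaction U lam

/-! ## The free covariance -/

/-- The pairing `⟨k, x⟩` of the momentum `k = 2π m / L` in `Γ* = (2πℤ/L)ᵈ / (2πℤ)ᵈ` with `x ∈ Γ`.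
The momentum is represented by `m ∈ (ℤ/Lℤ)ᵈ`; with the representatives in `{0, …, L - 1}` chosen
here the pairing is determined as a real number, and other representatives change it by an
element of `2πℤ`. It is used only under `cos` and `exp (i ·)`. -/
def pairing {d L : ℕ} (m x : Lattice d L) : ℝ :=
  ∑ l : Fin d, (2 * Real.pi * ((m l).val : ℝ) / (L : ℝ)) * ((x l).val : ℝ)

/-- The dispersion relation `E_k`, `k = 2π m / L`. -/
def dispersion {d L : ℕ} (t t' μ : ℝ) (m : Lattice d L) : ℝ :=
  -2 * t * (∑ j : Fin d, Real.cos (pairing m (unitVec j)))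
    - 4 * t' * (if 2 ≤ d then 1 else 0) * (∑ j : Fin d, ∑ k : Fin d, if j < k then
        Real.cos (pairing m (unitVec j)) * Real.cos (pairing m (unitVec k)) else 0)
    - μ

/-- The covariance `C(xσx, yτy)`, with `X = (x, σ)` at the time `a` and `Y = (y, τ)` at the
time `b`. -/
def covariance {d L : ℕ} [NeZero L] (t t' μ β : ℝ)
    (X : Lattice d L × Spin) (a : ℝ) (Y : Lattice d L × Spin) (b : ℝ) : ℂ :=
  ((kron X.2 Y.2 / (L : ℝ) ^ d : ℝ) : ℂ) *
    ∑ m : Lattice d L,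
      Complex.exp (Complex.I * ((pairing m (Y.1 - X.1) : ℝ) : ℂ)) *
        ((Real.exp (-(b - a) * dispersion t t' μ m) *
          ((if b - a ≤ 0 then 1 else 0) / (1 + Real.exp (β * dispersion t t' μ m))
            - (if 0 < b - a then 1 else 0) / (1 + Real.exp (-β * dispersion t t' μ m))) : ℝ) : ℂ)

/-! ## The terms of the perturbation series

The indices `1, …, 2n` are numbered from `0` here, so that the pair `2j - 1, 2j` becomes the pair
`2j, 2j + 1`, for `j = 0, …, n - 1`. -/

/-- The first index of the `j`-th pair. -/
def fstIdx {n : ℕ} (j : Fin n) : Fin (2 * n) := ⟨2 * (j : ℕ), by omega⟩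

/-- The second index of the `j`-th pair. -/
def sndIdx {n : ℕ} (j : Fin n) : Fin (2 * n) := ⟨2 * (j : ℕ) + 1, by omega⟩

/-- The pair to which an index belongs. -/
def pairIdx {n : ℕ} (i : Fin (2 * n)) : Fin n := ⟨(i : ℕ) / 2, by omega⟩

/-- The determinant of `(C(x_j σ_j s_j, y_k σ_k s_k))` of size `2n`, where the two indices of
the `j`-th pair carry the same time `s j`. -/
def covarianceDet {d L n : ℕ} [NeZero L] (t t' μ β : ℝ) (x y : Fin (2 * n) → Lattice d L)
    (σ : Fin (2 * n) → Spin) (s : Fin n → ℝ) : ℂ :=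
  Matrix.det (Matrix.of fun j k : Fin (2 * n) =>
    covariance t t' μ β (x j, σ j) (s (pairIdx j)) (y k, σ k) (s (pairIdx k)))

/-- The `n`-th term of the perturbation series. -/
def seriesTerm {d L : ℕ} [NeZero L] (t t' μ β U : ℝ)
    (lam : Lattice d L → Lattice d L → Lattice d L → Lattice d L → ℝ) (n : ℕ) : ℂ :=
  (1 / (Nat.factorial n : ℂ)) *
    ∑ x : Fin (2 * n) → Lattice d L, ∑ y : Fin (2 * n) → Lattice d L,
      ∑ σ : Fin (2 * n) → Spin,
        ((∏ j : Fin n, -(kron (σ (fstIdx j)) Spin.up * kron (σ (sndIdx j)) Spin.down *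
            coupling U lam (x (fstIdx j)) (x (sndIdx j)) (y (fstIdx j)) (y (sndIdx j))) : ℝ) : ℂ) *
          ∫ s in Set.Icc (0 : Fin n → ℝ) (fun _ => β), covarianceDet t t' μ β x y σ s

end Hubbard

end

/-!
Put `W(s) = e^{sH₀} e^{-sH_λ}` and `V(s) = e^{sH₀} V_λ e^{-sH₀}`. Then `W' = -V W`, and iterating
the integrated equation gives the Dyson series `W(β) = ∑ₙ (-1)ⁿ ∫_{β > s₁ > ⋯ > sₙ ≥ 0} V(s₁) ⋯
V(sₙ)` (`hasSum_dyson`). Since `e^{-βH₀} W(β) = e^{-βH_λ}`, applying the free thermal expectation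
`A ↦ Tr (e^{-βH₀} A) / Tr e^{-βH₀}` to both sides expresses the quotient of the partition functions
by the free expectations of `V(s₁) ⋯ V(sₙ)` at decreasing times. The division is legitimate:
`e^{-βH₀} = B^* B` with an invertible `B`, so its trace is positive (`Tr_exp_neg_ne_zero`).

The free expectations are computed by Wick's theorem. Because the spins in `ψ_{x↑}^* ψ_{y↓}^*
ψ_{w↓} ψ_{z↑}` differ, this operator equals `(ψ_{x↑}^* ψ_{z↑}) (ψ_{y↓}^* ψ_{w↓})`, so that `V(s₁) ⋯
V(sₙ)` is a linear combination of products `a₁ b₁ ⋯ a_N b_N`, `N = 2n`, of evolved creation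
operators `a_i` and annihilation operators `b_i`. The expectation of such a product is the
determinant of the matrix with the entries `ω(a_i b_j)` for `i ≤ j` and `-ω(b_j a_i)` for `i > j`
(`exp_ofFn_prod_eq_det`). Besides the anti-commutation relations this uses only that each `a_i` is
a combination of plane waves, that is of eigenvectors of the commutator with `H₀`: such an
eigenvector is multiplied by a number `κ = e^{βE}` when it is moved around the trace, and moving it
through the letters produces the contractions. In order to avoid signs of permutations, the
induction runs over sub-products with one unpaired `a` and one unpaired `b`: contracting `a` with
the partner `b_p` of some `a_p` leaves `a_p` unpaired, and the factor `-1` which arises is that of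
an exchange of two rows of the determinant (`insertedExp_eq`, `det_updateRow_rowsOn`). The
eigenvalues are the `E_k`, which identifies the entries with the covariance.

Finally, the sum over all sites and spins of the determinants is a symmetric function of the times,
and the cube `[0, β]ⁿ` consists, up to a null set, of the `n!` images of the simplex of decreasing
times (`setIntegral_Icc_eq_factorial_mul`). This is where the factor `1 / n!` comes from.
-/

namespace Hubbard

/-! ### The canonical anti-commutation relations -/

section CAR

/-- The `n`-particle wave function of a Fock vector, for every `n : ℕ`; it is zero for
`n > ♯S`, where the Fock space has no component. -/
noncomputable def wave {S : Type} [Fintype S] (φ : Fock S) (n : ℕ) (x : Fin n → S) : ℂ :=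
  if h : n < Fintype.card S + 1 then (Subtype.val φ : FullFock S) ⟨⟨n, h⟩, x⟩ else 0

/-- The sum `∑_π sgn π f(y ∘ π)` vanishes as soon as two of the variables coincide. -/
theorem sum_sign_comp_eq_zero {S : Type} {n : ℕ} (f : (Fin n → S) → ℂ) (y : Fin n → S)
    (hy : ¬ Function.Injective y) :
    ∑ π : Equiv.Perm (Fin n), ((Equiv.Perm.sign π : ℤ) : ℂ) * f (y ∘ π) = 0 := by
  simp only [Function.Injective, not_forall] at hy
  obtain ⟨i, j, hij, hne⟩ := hy
  have hs : y ∘ Equiv.swap i j = y := by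
    funext k
    simp only [Function.comp, Equiv.swap_apply_def]
    split_ifs with h1 h2
    · rw [h1, hij]
    · rw [h2, hij]
    · rfl
  have := Fintype.sum_equiv (Equiv.mulLeft (Equiv.swap i j))
    (fun π : Equiv.Perm (Fin n) => ((Equiv.Perm.sign π : ℤ) : ℂ) * f (y ∘ π))
    (fun π : Equiv.Perm (Fin n) => -(((Equiv.Perm.sign π : ℤ) : ℂ) * f (y ∘ π)))
    (fun π => by
      simp only [Equiv.coe_mulLeft, Equiv.Perm.sign_mul, Equiv.Perm.sign_swap hne,
        Equiv.Perm.coe_mul, ← Function.comp_assoc, hs]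
      simp)
  rw [Finset.sum_neg_distrib] at this
  exact self_eq_neg.1 this

variable {S : Type} [Fintype S]

theorem wave_ext {φ χ : Fock S} (h : ∀ n x, wave φ n x = wave χ n x) : φ = χ := by
  refine Subtype.ext ?_
  ext ⟨n, x⟩
  have := h n x
  simpa [wave, n.2] using this

theorem wave_add (φ χ : Fock S) (n : ℕ) (x : Fin n → S) :
    wave (φ + χ) n x = wave φ n x + wave χ n x := by
  have : (Subtype.val (φ + χ) : FullFock S) = Subtype.val φ + Subtype.val χ := rfl
  unfold wave
  rw [this]
  split_ifs <;> simp

theorem wave_smul (c : ℂ) (φ : Fock S) (n : ℕ) (x : Fin n → S) :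
    wave (c • φ) n x = c * wave φ n x := by
  have : (Subtype.val (c • φ) : FullFock S) = c • Subtype.val φ := rfl
  unfold wave
  rw [this]
  split_ifs <;> simp

theorem wave_zero (n : ℕ) (x : Fin n → S) : wave (0 : Fock S) n x = 0 := by
  have : (Subtype.val (0 : Fock S) : FullFock S) = 0 := rfl
  unfold wave
  rw [this]
  split_ifs <;> simp

theorem wave_comp_perm (φ : Fock S) (n : ℕ) (x : Fin n → S) (π : Equiv.Perm (Fin n)) :
    wave φ n (x ∘ π) = ((Equiv.Perm.sign π : ℤ) : ℂ) * wave φ n x := by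
  unfold wave
  split_ifs with h
  · exact (mem_fockSpace_iff _).1 φ.2 ⟨n, h⟩ x π
  · simp

theorem wave_annihilate (s : S) (φ : Fock S) (n : ℕ) (x : Fin n → S) :
    wave (annihilate s φ) n x =
      ((Real.sqrt ((n : ℝ) + 1) : ℝ) : ℂ) * wave φ (n + 1) (Fin.cons s x) := by
  have h0 : (Subtype.val (annihilate s φ) : FullFock S) = annihilateFull s (Subtype.val φ) := rfl
  unfold wave
  rw [h0]
  by_cases h : n + 1 < Fintype.card S + 1
  · have h' : n < Fintype.card S + 1 := by omega
    simp only [annihilateFull, LinearMap.coe_mk, AddHom.coe_mk, h, h', dif_pos]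
  · simp only [annihilateFull, LinearMap.coe_mk, AddHom.coe_mk, h, dif_neg, not_false_eq_true,
      mul_zero, dite_eq_ite, ite_self]

theorem op_mul_apply (A B : Op S) (φ : Fock S) : (A * B) φ = A (B φ) := rfl

theorem inner_eq_sum_wave (φ χ : Fock S) :
    inner ℂ φ χ = ∑ n ∈ Finset.range (Fintype.card S + 1), ∑ x : Fin n → S,
      (starRingEnd ℂ) (wave φ n x) * wave χ n x := by
  have h0 : inner ℂ φ χ = inner ℂ (Subtype.val φ : FullFock S) (Subtype.val χ : FullFock S) := rfl
  rw [h0, PiLp.inner_apply, Fintype.sum_sigma, Finset.sum_range]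
  refine Finset.sum_congr rfl fun n _ => Finset.sum_congr rfl fun x _ => ?_
  simp only [wave, n.2, dif_pos, Fin.eta, RCLike.inner_apply]
  exact mul_comm _ _

open Classical in
/-- The product `(t ⊗ φ)(y₀, …, yₙ) = δ_{y₀, t} φ(y₁, …, yₙ)`, which is not anti-symmetric. -/
noncomputable def tensorWave (t : S) (φ : Fock S) (n : ℕ) (y : Fin (n + 1) → S) : ℂ :=
  if y 0 = t then wave φ n (Fin.tail y) else 0

/-- The family `√n • (t ⊗ φ)` of all wave functions, whose anti-symmetrization is `ψ_t^* φ`. -/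
noncomputable def preCreate (t : S) (φ : Fock S) (n : ℕ) : (Fin n → S) → ℂ :=
  match n with
  | 0 => fun _ => 0
  | n + 1 => fun y => ((Real.sqrt ((n : ℝ) + 1) : ℝ) : ℂ) * tensorWave t φ n y

/-- The creation operator, defined as an adjoint, is the anti-symmetrized product with `δ_t`. This
also holds for `n > ♯S`, where both sides vanish. -/
theorem wave_create (t : S) (φ : Fock S) (n : ℕ) (y : Fin n → S) :
    wave (create t φ) n y = ((n.factorial : ℕ) : ℂ)⁻¹ *
      ∑ π : Equiv.Perm (Fin n), ((Equiv.Perm.sign π : ℤ) : ℂ) * preCreate t φ n (y ∘ π) := by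
  classical
  let η : FullFock S := WithLp.toLp 2 fun p => preCreate t φ (p.1 : ℕ) p.2
  let c : Fock S := (⟨antisymmetrizer S η, ⟨η, rfl⟩⟩ : ↥(fockSpace S))
  have hc : ∀ n (x : Fin n → S), n < Fintype.card S + 1 → wave c n x =
      ((n.factorial : ℕ) : ℂ)⁻¹ *
      ∑ π : Equiv.Perm (Fin n), ((Equiv.Perm.sign π : ℤ) : ℂ) * preCreate t φ n (x ∘ π) := by
    intro n x h
    simp [wave, h, c, antisymmetrizer, η]
  have key : create t φ = c := by
    refine ext_inner_right ℂ fun χ => ?_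
    unfold create
    rw [ContinuousLinearMap.adjoint_inner_left, inner_eq_sum_wave, inner_eq_sum_wave]
    -- anti-symmetrization can be dropped when paired with an anti-symmetric function
    have h1 : ∀ n ∈ Finset.range (Fintype.card S + 1), ∑ x : Fin n → S,
        (starRingEnd ℂ) (wave c n x) * wave χ n x =
        ∑ x : Fin n → S, (starRingEnd ℂ) (preCreate t φ n x) * wave χ n x := by
      intro n hn
      have h2 : ∀ π : Equiv.Perm (Fin n), ∑ x : Fin n → S,
          ((Equiv.Perm.sign π : ℤ) : ℂ) * (starRingEnd ℂ) (preCreate t φ n (x ∘ π)) * wave χ n x =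
          ∑ x : Fin n → S, (starRingEnd ℂ) (preCreate t φ n x) * wave χ n x := by
        intro π
        refine Fintype.sum_equiv (Equiv.arrowCongr π.symm (Equiv.refl S)) _ _ fun x => ?_
        have : (Equiv.arrowCongr π.symm (Equiv.refl S)) x = x ∘ π := by
          funext i; simp [Equiv.arrowCongr]
        rw [this, wave_comp_perm]
        ring
      have h3 : ∀ x : Fin n → S, (starRingEnd ℂ) (wave c n x) * wave χ n x =
          ((n.factorial : ℕ) : ℂ)⁻¹ * ∑ π : Equiv.Perm (Fin n), ((Equiv.Perm.sign π : ℤ) : ℂ) *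
            (starRingEnd ℂ) (preCreate t φ n (x ∘ π)) * wave χ n x := by
        intro x
        rw [hc n x (Finset.mem_range.1 hn)]
        simp [Finset.sum_mul, mul_assoc]
      simp only [h3]
      rw [← Finset.mul_sum, Finset.sum_comm, Finset.sum_congr rfl fun π _ => h2 π]
      simp [Fintype.card_perm, Nat.factorial_ne_zero]
    rw [Finset.sum_congr rfl h1, Finset.sum_range_succ, Finset.sum_range_succ']
    have h4 : ∀ x : Fin (Fintype.card S) → S, wave (annihilate t χ) (Fintype.card S) x = 0 := by
      intro x
      rw [wave_annihilate]
      simp [wave]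
    simp only [h4, mul_zero, Finset.sum_const_zero, add_zero]
    have h5 : ∑ x : Fin 0 → S, (starRingEnd ℂ) (preCreate t φ 0 x) * wave χ 0 x = 0 := by
      simp [preCreate]
    rw [h5, add_zero]
    refine Finset.sum_congr rfl fun n _ => ?_
    rw [← (Fin.consEquiv fun _ : Fin (n + 1) => S).sum_comp, Fintype.sum_prod_type]
    rw [Finset.sum_eq_single t]
    · refine Finset.sum_congr rfl fun x _ => ?_
      rw [wave_annihilate]
      simp [preCreate, tensorWave, Fin.consEquiv]
      ring
    · intro s _ hs
      simp [preCreate, tensorWave, Fin.consEquiv, hs]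
    · simp
  by_cases h : n < Fintype.card S + 1
  · rw [key, hc n y h]
  · rw [sum_sign_comp_eq_zero (preCreate t φ n) y]
    · simp [wave, h]
    · intro hinj
      have := Fintype.card_le_of_injective y hinj
      simp at this
      omega

theorem wave_create_zero (t : S) (φ : Fock S) (y : Fin 0 → S) : wave (create t φ) 0 y = 0 := by
  rw [wave_create]
  simp [preCreate]

open Classical in
/-- The sum over permutations in `wave_create` collapses to the choice of the variable that is
moved to the front, because `φ` is already anti-symmetric in the others. -/
theorem wave_create_succ (t : S) (φ : Fock S) (n : ℕ) (y : Fin (n + 1) → S) :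
    ((Real.sqrt ((n : ℝ) + 1) : ℝ) : ℂ) * wave (create t φ) (n + 1) y =
      ∑ p : Fin (n + 1), (if p = 0 then 1 else -1) *
        (if y p = t then wave φ n (fun i => y (Equiv.swap 0 p i.succ)) else 0) := by
  -- a permutation of `n + 1` places is a transposition `(0 p)` after one of the last `n` places
  rw [wave_create, ← Equiv.Perm.decomposeFin.symm.sum_comp, Fintype.sum_prod_type]
  have hterm : ∀ (p : Fin (n + 1)) (e : Equiv.Perm (Fin n)),
      ((Equiv.Perm.sign (Equiv.Perm.decomposeFin.symm (p, e)) : ℤ) : ℂ) *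
        preCreate t φ (n + 1) (y ∘ Equiv.Perm.decomposeFin.symm (p, e)) =
      ((Real.sqrt ((n : ℝ) + 1) : ℝ) : ℂ) * ((if p = 0 then 1 else -1) *
        (if y p = t then wave φ n (fun i => y (Equiv.swap 0 p i.succ)) else 0)) := by
    intro p e
    have htail : Fin.tail (y ∘ Equiv.Perm.decomposeFin.symm (p, e)) =
        (fun i => y (Equiv.swap 0 p i.succ)) ∘ e := by
      funext i
      simp [Fin.tail]
    have hsq : ((Equiv.Perm.sign e : ℤ) : ℂ) * ((Equiv.Perm.sign e : ℤ) : ℂ) = 1 := by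
      rw [← Int.cast_mul, ← Units.val_mul, Int.units_mul_self]; simp
    simp only [preCreate, tensorWave, htail, wave_comp_perm, Equiv.Perm.decomposeFin.symm_sign,
      Function.comp, Equiv.Perm.decomposeFin_symm_apply_zero]
    by_cases h0 : p = 0 <;> by_cases h1 : y p = t <;> simp [h0, h1]
    · subst h0
      simp only [h1, if_true]
      linear_combination (Real.sqrt ((n : ℝ) + 1) : ℂ) * wave φ n (fun i => y i.succ) * hsq
    · subst h0
      simp [h1]
    · linear_combination (Real.sqrt ((n : ℝ) + 1) : ℂ) *
        wave φ n (fun i => y (Equiv.swap 0 p i.succ)) * hsq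
  simp only [hterm, Finset.sum_const, Finset.card_univ, Fintype.card_perm, Fintype.card_fin,
    nsmul_eq_mul]
  rw [← Finset.mul_sum, ← Finset.mul_sum]
  have hs : ((Real.sqrt ((n : ℝ) + 1) : ℝ) : ℂ) * ((Real.sqrt ((n : ℝ) + 1) : ℝ) : ℂ) =
      (n : ℂ) + 1 := by
    rw [← Complex.ofReal_mul, Real.mul_self_sqrt (by positivity)]
    simp
  have hf : ((n.factorial : ℕ) : ℂ) ≠ 0 := by exact_mod_cast n.factorial_ne_zero
  have hn : ((n : ℂ) + 1) ≠ 0 := by exact_mod_cast n.succ_ne_zero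
  rw [Nat.factorial_succ]
  push_cast
  field_simp
  rw [pow_two, hs]

open Classical in
/-- On `n`-particle functions, `ψ_s ψ_t^*` is `δ_{s,t}` minus the operator replacing each variable
equal to `t` by `s`. For `n = ♯S` the left-hand side is zero. -/
theorem wave_annihilate_create (s t : S) (φ : Fock S) (n : ℕ) (x : Fin n → S) :
    wave (annihilate s (create t φ)) n x = (if s = t then wave φ n x else 0) -
      ∑ j : Fin n, if x j = t then wave φ n (Function.update x j s) else 0 := by
  rw [wave_annihilate, wave_create_succ, Fin.sum_univ_succ]
  simp only [if_true, Fin.cons_zero, Equiv.swap_self, Equiv.refl_apply, Fin.cons_succ, one_mul,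
    Fin.succ_ne_zero, if_false, neg_one_mul, Finset.sum_neg_distrib, sub_eq_add_neg]
  congr 2
  refine Finset.sum_congr rfl fun j _ => ?_
  have : (fun i : Fin n => (Fin.cons s x : Fin (n + 1) → S) (Equiv.swap 0 j.succ i.succ)) =
      Function.update x j s := by
    funext i
    by_cases h : i = j
    · subst h; simp
    · rw [Equiv.swap_apply_of_ne_of_ne (Fin.succ_ne_zero i) (by simpa using h)]
      simp [h]
  rw [this]

open Classical in
theorem wave_create_annihilate (s t : S) (φ : Fock S) (n : ℕ) (x : Fin n → S) :
    wave (create t (annihilate s φ)) n x =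
      ∑ j : Fin n, if x j = t then wave φ n (Function.update x j s) else 0 := by
  cases n with
  | zero => rw [wave_create_zero]; simp
  | succ n =>
    have hs : ((Real.sqrt ((n : ℝ) + 1) : ℝ) : ℂ) ≠ 0 := by
      rw [Complex.ofReal_ne_zero]
      positivity
    refine mul_left_cancel₀ hs ?_
    rw [wave_create_succ, Finset.mul_sum]
    refine Finset.sum_congr rfl fun p _ => ?_
    split_ifs with h0 h1 h1
    · subst h0
      rw [wave_annihilate, one_mul]
      congr 2
      funext i
      refine Fin.cases ?_ (fun i => ?_) i <;> simp
    · simp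
    · rw [wave_annihilate]
      have hx : (Fin.cons s fun i : Fin n => x (Equiv.swap 0 p i.succ) : Fin (n + 1) → S) =
          Function.update x p s ∘ Equiv.swap 0 p := by
        funext i
        refine Fin.cases ?_ (fun i => ?_) i
        · simp
        · have : Equiv.swap 0 p i.succ ≠ p := by
            intro h
            rw [Equiv.swap_apply_eq_iff, Equiv.swap_apply_right] at h
            exact Fin.succ_ne_zero i h
          simp [Function.update_of_ne this]
      rw [hx, wave_comp_perm, Equiv.Perm.sign_swap (Ne.symm h0)]
      push_cast
      ring
    · simp

theorem annihilate_create_anticomm [DecidableEq S] (s t : S) :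
    annihilate s * create t + create t * annihilate s = (if s = t then (1 : ℂ) else 0) • 1 := by
  refine ContinuousLinearMap.ext fun φ => wave_ext fun n x => ?_
  simp only [add_apply, smul_apply, op_mul_apply, wave_add, one_apply_eq_self, wave_smul]
  rw [wave_annihilate_create, wave_create_annihilate, sub_add_cancel]
  by_cases h : s = t <;> simp [h]

theorem annihilate_annihilate_anticomm (s t : S) :
    annihilate s * annihilate t + annihilate t * annihilate s = 0 := by
  refine ContinuousLinearMap.ext fun φ => wave_ext fun n x => ?_
  simp only [add_apply, op_mul_apply, wave_add, zero_apply, wave_zero, wave_annihilate]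
  have h : (Fin.cons s (Fin.cons t x : Fin (n + 1) → S) : Fin (n + 2) → S) =
      (Fin.cons t (Fin.cons s x : Fin (n + 1) → S) : Fin (n + 2) → S) ∘ Equiv.swap 0 1 := by
    funext i
    refine Fin.cases ?_ (fun i => ?_) i
    · simp only [Function.comp, Equiv.swap_apply_left, Fin.cons_zero]
      rw [← Fin.succ_zero_eq_one, Fin.cons_succ, Fin.cons_zero]
    · refine Fin.cases ?_ (fun i => ?_) i
      · simp
      · have h1 : i.succ.succ ≠ (1 : Fin (n + 2)) := fun h => by
          have := congrArg Fin.val h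
          simp at this
        rw [Function.comp, Equiv.swap_apply_of_ne_of_ne (Fin.succ_ne_zero _) h1]
        simp
  rw [h, wave_comp_perm, Equiv.Perm.sign_swap (by simp)]
  push_cast
  ring

theorem create_create_anticomm (s t : S) :
    create s * create t + create t * create s = 0 := by
  have h := congrArg star (annihilate_annihilate_anticomm t s)
  simpa [create, ← ContinuousLinearMap.star_eq_adjoint] using h

end CAR

/-! ### Ordered products in a ring -/

section OrderedProducts

variable {A : Type*} [Ring A]

/-- The ordered product `g 0 * g 1 * ⋯ * g (p - 1)`. -/
def before (g : ℕ → A) (p : ℕ) : A := ((List.range p).map g).prod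

/-- The ordered product `g p * g (p + 1) * ⋯ * g (N - 1)`. -/
def after (g : ℕ → A) (N p : ℕ) : A := ((List.range' p (N - p)).map g).prod

theorem before_succ (g : ℕ → A) (p : ℕ) : before g (p + 1) = before g p * g p := by
  simp [before, List.range_succ]

theorem after_of_lt (g : ℕ → A) {N p : ℕ} (h : p < N) :
    after g N p = g p * after g N (p + 1) := by
  obtain ⟨k, rfl⟩ := Nat.exists_eq_add_of_lt h
  have h1 : p + k + 1 - p = k + 1 := by omega
  have h2 : p + k + 1 - (p + 1) = k := by omega
  simp [after, h1, h2, List.range'_succ]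

theorem after_self (g : ℕ → A) (N : ℕ) : after g N N = 1 := by simp [after]

theorem before_mul_after (g : ℕ → A) {N p : ℕ} (h : p ≤ N) :
    before g p * after g N p = before g N := by
  induction h using Nat.decreasingInduction with
  | self => rw [after_self, mul_one]
  | of_succ k hk ih => rw [after_of_lt g hk, ← mul_assoc, ← before_succ, ih]

theorem before_congr {g h : ℕ → A} {p : ℕ} (H : ∀ l < p, g l = h l) : before g p = before h p := by
  unfold before
  congr 1
  exact List.map_congr_left fun l hl => H l (List.mem_range.1 hl)

theorem after_congr {g h : ℕ → A} {N p : ℕ} (H : ∀ l, p ≤ l → l < N → g l = h l) :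
    after g N p = after h N p := by
  unfold after
  congr 1
  refine List.map_congr_left fun l hl => ?_
  rw [List.mem_range'_1] at hl
  exact H l hl.1 (by omega)

theorem before_eq_ofFn_prod (N : ℕ) (g : ℕ → A) :
    before g N = (List.ofFn fun i : Fin N => g i).prod := by
  rw [before, List.ofFn_eq_map, ← List.map_coe_finRange_eq_range, List.map_map]
  rfl

end OrderedProducts

/-! ### Wick's theorem for functionals with a KMS property -/

section Wick

variable {A : Type*} [Ring A] [Algebra ℂ A] (ω : A →ₗ[ℂ] ℂ) (a b : ℕ → A) (N : ℕ)

/-- The letters of the word `∏_{l ∈ s} a_l b_l`, with `1` at the places outside `s`. -/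
def pairWord (s : Finset ℕ) (l : ℕ) : A := if l ∈ s then a l * b l else 1

/-- The letters of the word `∏_{l ∈ s} a_l b_l` with an extra letter `b_j` at the place `j`. -/
def oddWord (j : ℕ) (s : Finset ℕ) (l : ℕ) : A := if l = j then b l else pairWord a b s l

/-- The ordered two-point function of `x`, at the place `i`, and `b_p`. At equal places `x`
stands to the left. -/
def twoPoint (x : A) (i p : ℕ) : ℂ := if i ≤ p then ω (x * b p) else -ω (b p * x)

/-- The sign of the permutation that moves `b_j` to the right of a letter at the place `i`. -/
def orderSign (i j : ℕ) : ℂ := if i ≤ j then 1 else -1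

/-- The expectation of `∏_{l ∈ s} a_l b_l` with `x` inserted at the place `i` and `b_j` at the
place `j`, with the sign of the order of the two. -/
def insertedExp (x : A) (i j : ℕ) (s : Finset ℕ) : ℂ :=
  orderSign i j * ω (before (oddWord a b j s) i * x * after (oddWord a b j s) N i)

/-- The linear span of the elements that are multiplied by a number `κ ≠ -1` when they are moved
around the functional `ω`, anti-commute with all `a_l`, and have scalar anti-commutators with
all `b_l`. -/
def modeSpan : Submodule ℂ A :=
  Submodule.span ℂ {x | ∃ κ : ℂ, 1 + κ ≠ 0 ∧ (∀ X, ω (X * x) = κ * ω (x * X)) ∧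
    (∀ l, x * a l + a l * x = 0) ∧ ∀ l, ∃ c : ℂ, x * b l + b l * x = c • 1}

variable {ω a b N}

/-- Moving `x` through the pair `a_p b_p`: the letter `a_p` is left without its partner, at the
same place. -/
theorem sub_insertedExp_of_mem {x : A} {j p : ℕ} {s : Finset ℕ} (hj : j ∉ s) (hp : p ∈ s)
    (hpN : p < N) (ha : ∀ l, x * a l + a l * x = 0) {c : ℂ} (hc : x * b p + b p * x = c • 1) :
    insertedExp ω a b N x p j s - insertedExp ω a b N x (p + 1) j s =
      -c * insertedExp ω a b N (a p) p j (s.erase p) := by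
  have hpj : p ≠ j := fun h => hj (h ▸ hp)
  have hsign : orderSign (p + 1) j = orderSign p j := by
    unfold orderSign
    have : p + 1 ≤ j ↔ p ≤ j := by omega
    simp only [this]
  have hg : oddWord a b j s p = a p * b p := by simp [oddWord, pairWord, hp, hpj]
  have hcomm : x * (a p * b p) - (a p * b p) * x = -c • a p := by
    have h1 : x * a p = -(a p * x) := eq_neg_of_add_eq_zero_left (ha p)
    have h2 : x * b p = c • 1 - b p * x := eq_sub_of_add_eq hc
    rw [← mul_assoc, h1, neg_mul, mul_assoc, h2, mul_assoc, mul_sub]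
    simp
  have hb : before (oddWord a b j (s.erase p)) p = before (oddWord a b j s) p :=
    before_congr fun l hl => by simp [oddWord, pairWord, hl.ne]
  have haft : after (oddWord a b j (s.erase p)) N p = after (oddWord a b j s) N (p + 1) := by
    rw [after_of_lt _ hpN]
    have h1 : oddWord a b j (s.erase p) p = 1 := by simp [oddWord, pairWord, hpj]
    rw [h1, one_mul]
    refine after_congr fun l hl _ => ?_
    have : l ≠ p := by omega
    simp [oddWord, pairWord, this]
  unfold insertedExp
  rw [hsign, before_succ, after_of_lt _ hpN, hg, hb, haft, ← mul_sub, ← map_sub]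
  have h3 : ∀ B C : A, B * x * (a p * b p * C) - B * (a p * b p) * x * C =
      -c • (B * a p * C) := by
    intro B C
    have : B * x * (a p * b p * C) - B * (a p * b p) * x * C =
        B * (x * (a p * b p) - (a p * b p) * x) * C := by noncomm_ring
    rw [this, hcomm]
    simp
  rw [h3, map_smul, smul_eq_mul]
  ring

/-- Moving `x` through the unpaired letter `b_j`: both are removed. The sign in `insertedExp` turns
the commutator into an anti-commutator. -/
theorem sub_insertedExp_self {x : A} {j : ℕ} {s : Finset ℕ} (hj : j ∉ s)
    (hjN : j < N) {c : ℂ} (hc : x * b j + b j * x = c • 1) :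
    insertedExp ω a b N x j j s - insertedExp ω a b N x (j + 1) j s =
      c * ω (before (pairWord a b s) N) := by
  have hg : oddWord a b j s j = b j := by simp [oddWord]
  have hb : before (oddWord a b j s) j = before (pairWord a b s) j :=
    before_congr fun l hl => by simp [oddWord, hl.ne]
  have haft : after (oddWord a b j s) N (j + 1) = after (pairWord a b s) N j := by
    rw [after_of_lt _ hjN]
    have h1 : pairWord a b s j = 1 := by simp [pairWord, hj]
    rw [h1, one_mul]
    refine after_congr fun l hl _ => ?_
    have : l ≠ j := by omega
    simp [oddWord, this]
  rw [← before_mul_after (pairWord a b s) hjN.le]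
  unfold insertedExp
  rw [before_succ, after_of_lt _ hjN, hg, hb, haft]
  simp only [orderSign, le_refl, if_true, Nat.not_succ_le_self, if_false, one_mul, neg_mul,
    sub_neg_eq_add, ← map_add]
  have h3 : ∀ B C : A, B * x * (b j * C) + B * b j * x * C = c • (B * C) := by
    intro B C
    have : B * x * (b j * C) + B * b j * x * C = B * (x * b j + b j * x) * C := by noncomm_ring
    rw [this, hc]
    simp
  rw [h3, map_smul, smul_eq_mul]

theorem sub_insertedExp_of_notMem {x : A} {j p : ℕ} {s : Finset ℕ} (hp : p ∉ s) (hpj : p ≠ j)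
    (hpN : p < N) :
    insertedExp ω a b N x p j s - insertedExp ω a b N x (p + 1) j s = 0 := by
  have hsign : orderSign (p + 1) j = orderSign p j := by
    unfold orderSign
    have : p + 1 ≤ j ↔ p ≤ j := by omega
    simp only [this]
  have hg : oddWord a b j s p = 1 := by simp [oddWord, pairWord, hp, hpj]
  unfold insertedExp
  rw [hsign, before_succ, after_of_lt _ hpN, hg]
  simp

/-- Wick's theorem for one letter: `x` is contracted with each letter `b_p`. After the contraction
with `b_p`, `p ∈ s`, the letter `a_p` has lost its partner and takes over the role of `x`, whence
the minus sign. To see this, `x` is moved once around the functional `ω`. -/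
theorem insertedExp_eq (hω : ω 1 = 1) {x : A} (hx : x ∈ modeSpan ω a b) {i j : ℕ} {s : Finset ℕ}
    (hj : j ∉ s) (hi : i < N) (hjN : j < N) :
    insertedExp ω a b N x i j s = twoPoint ω b x i j * ω (before (pairWord a b s) N) -
      ∑ p ∈ Finset.range N, if p ∈ s then
        twoPoint ω b x i p * insertedExp ω a b N (a p) p j (s.erase p) else 0 := by
  unfold modeSpan at hx
  induction hx using Submodule.span_induction with
  | mem x hx =>
    obtain ⟨κ, hκ, hcyc, ha, hb⟩ := hx
    choose c hc using hb
    have h1 : ∀ p, ω (x * b p) = c p / (1 + κ) := by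
      intro p
      have h2 := congrArg ω (hc p)
      rw [map_add, hcyc, map_smul, hω] at h2
      rw [eq_div_iff hκ]
      simp only [smul_eq_mul, mul_one] at h2
      linear_combination h2
    set R : ℕ → ℂ := fun p =>
      insertedExp ω a b N x p j s - insertedExp ω a b N x (p + 1) j s with hR
    have hRval : ∀ p < N, R p = if p ∈ s then
        -c p * insertedExp ω a b N (a p) p j (s.erase p) else
        if p = j then c p * ω (before (pairWord a b s) N) else 0 := by
      intro p hp
      split_ifs with h2 h3
      · exact sub_insertedExp_of_mem hj h2 hp ha (hc p)
      · subst h3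
        exact sub_insertedExp_self hj hp (hc p)
      · exact sub_insertedExp_of_notMem h2 h3 hp
    -- `R p` is the contraction with `b_p`; its coefficient in the expectation comes from the
    -- telescoping sum, which is closed up by the cyclicity `hend`
    have htel : ∀ n, ∑ p ∈ Finset.range n, R p =
        insertedExp ω a b N x 0 j s - insertedExp ω a b N x n j s := fun n =>
      Finset.sum_range_sub' (fun p => insertedExp ω a b N x p j s) n
    have hend : insertedExp ω a b N x N j s = -κ * insertedExp ω a b N x 0 j s := by
      unfold insertedExp orderSign
      -- at the place `N` the letter `x` stands to the right of `b_j`, whence the sign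
      have h4 : before (oddWord a b j s) N = after (oddWord a b j s) N 0 := by
        rw [← before_mul_after (oddWord a b j s) (Nat.zero_le N)]
        simp [before]
      rw [if_neg (by omega), if_pos (Nat.zero_le j), after_self, mul_one, hcyc, h4]
      simp [before]
    have hval : insertedExp ω a b N x i j s = ∑ p ∈ Finset.range N,
        (if i ≤ p then 1 / (1 + κ) else -(κ / (1 + κ))) * R p := by
      have h5 : ∀ p, (if i ≤ p then 1 / (1 + κ) else -(κ / (1 + κ))) * R p =
          (1 / (1 + κ)) * R p - if p < i then R p else 0 := by
        intro p
        by_cases h : i ≤ p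
        · simp [h, not_lt.2 h]
        · simp only [h, if_false, not_le.1 h, if_true]
          field_simp
          ring
      simp only [h5]
      rw [Finset.sum_sub_distrib, ← Finset.mul_sum, htel, hend, ← Finset.sum_filter]
      have h6 : (Finset.range N).filter (fun p => p < i) = Finset.range i := by
        ext p; simp; omega
      rw [h6, htel]
      field_simp
      ring
    have htwo : ∀ p, twoPoint ω b x i p =
        (if i ≤ p then 1 / (1 + κ) else -(κ / (1 + κ))) * c p := by
      intro p
      unfold twoPoint
      rw [hcyc, h1]
      split_ifs <;> ring
    have hj' : twoPoint ω b x i j * ω (before (pairWord a b s) N) =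
        ∑ p ∈ Finset.range N, if p = j then
          twoPoint ω b x i p * ω (before (pairWord a b s) N) else 0 := by
      rw [Finset.sum_ite_eq' (Finset.range N) j, if_pos (Finset.mem_range.2 hjN)]
    rw [hval, hj', ← Finset.sum_sub_distrib]
    refine Finset.sum_congr rfl fun p hp => ?_
    rw [hRval p (Finset.mem_range.1 hp), htwo]
    by_cases h2 : p ∈ s
    · have h3 : p ≠ j := fun h => hj (h ▸ h2)
      simp only [h2, h3, if_true, if_false]
      ring
    · simp only [h2, if_false, sub_zero]
      split_ifs <;> ring
  | zero => simp [insertedExp, twoPoint]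
  | add x y _ _ hx hy =>
    have h1 : insertedExp ω a b N (x + y) i j s =
        insertedExp ω a b N x i j s + insertedExp ω a b N y i j s := by
      simp [insertedExp, mul_add, add_mul]
    have h2 : ∀ p, twoPoint ω b (x + y) i p = twoPoint ω b x i p + twoPoint ω b y i p := by
      intro p
      unfold twoPoint
      split_ifs <;> simp [mul_add, add_mul]
      ring
    have h3 : ∀ p, (if p ∈ s then
        (twoPoint ω b x i p + twoPoint ω b y i p) * insertedExp ω a b N (a p) p j (s.erase p)
        else 0) = (if p ∈ s then
        twoPoint ω b x i p * insertedExp ω a b N (a p) p j (s.erase p) else 0) + if p ∈ s then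
        twoPoint ω b y i p * insertedExp ω a b N (a p) p j (s.erase p) else 0 := by
      intro p
      split_ifs <;> ring
    simp only [h1, hx, hy, h2, h3, Finset.sum_add_distrib]
    ring
  | smul r x _ hx =>
    have h1 : insertedExp ω a b N (r • x) i j s = r * insertedExp ω a b N x i j s := by
      simp [insertedExp]
      ring
    have h2 : ∀ p, twoPoint ω b (r • x) i p = r * twoPoint ω b x i p := by
      intro p
      unfold twoPoint
      split_ifs <;> simp
    rw [h1, hx, h2, mul_sub, Finset.mul_sum, mul_assoc]
    congr 1
    refine Finset.sum_congr rfl fun p _ => ?_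
    rw [h2]
    split_ifs <;> ring

variable (N) in
/-- The matrix whose rows with index in `s` are those of `C`, and whose other rows are those of
the identity matrix. Its determinant is the principal minor of `C` with index set `s`. -/
def rowsOn (C : ℕ → ℕ → ℂ) (s : Finset ℕ) : Matrix (Fin N) (Fin N) ℂ :=
  Matrix.of fun k => if (k : ℕ) ∈ s then fun p => C k p else Pi.single k 1

theorem rowsOn_insert (C : ℕ → ℕ → ℂ) (s : Finset ℕ) (j : Fin N) :
    rowsOn N C (insert (j : ℕ) s) = (rowsOn N C s).updateRow j fun p => C j p := by
  ext k p
  by_cases h : k = j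
  · subst h
    simp [rowsOn]
  · have : (k : ℕ) ≠ j := fun h' => h (Fin.ext h')
    simp [rowsOn, h, this]

/-- The expansion, along the row `j`, of the determinant with rows `s ∪ {i}` and columns
`s ∪ {j}`, where the row `i` is put into the place `j`. -/
theorem det_updateRow_rowsOn (C : ℕ → ℕ → ℂ) (s : Finset ℕ) (i : ℕ) (j : Fin N)
    (hj : (j : ℕ) ∉ s) :
    ((rowsOn N C s).updateRow j fun p => C i p).det = C i j * (rowsOn N C s).det -
      ∑ p : Fin N, if (p : ℕ) ∈ s then
        C i p * ((rowsOn N C (s.erase p)).updateRow j fun q => C p q).det else 0 := by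
  rw [Matrix.det_eq_sum_mul_adjugate_row _ j]
  simp only [Matrix.adjugate_apply, Matrix.updateRow_self, Matrix.updateRow_idem]
  have hj' : C i j * (rowsOn N C s).det =
      ∑ p : Fin N, if p = j then C i p * (rowsOn N C s).det else 0 := by simp
  rw [hj', ← Finset.sum_sub_distrib]
  refine Finset.sum_congr rfl fun p _ => ?_
  by_cases hpj : p = j
  · subst hpj
    have : (rowsOn N C s).updateRow p (Pi.single p 1) = rowsOn N C s := by
      ext k q
      by_cases h : k = p
      · subst h; simp [rowsOn, hj]
      · simp [h]
    simp [hj, this]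
  · by_cases hps : (p : ℕ) ∈ s
    · -- exchange of the rows `j` and `p`
      have hsw : ((rowsOn N C s).updateRow j (Pi.single p 1)) =
          (((rowsOn N C (s.erase p)).updateRow j fun q => C p q)).submatrix
            (Equiv.swap j p) id := by
        ext k q
        rw [Matrix.submatrix_apply]
        by_cases hkj : k = j
        · subst hkj
          rw [Equiv.swap_apply_left, Matrix.updateRow_self, Matrix.updateRow_ne hpj]
          simp [rowsOn]
        · by_cases hkp : k = p
          · subst hkp
            rw [Equiv.swap_apply_right, Matrix.updateRow_self, Matrix.updateRow_ne hkj]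
            simp [rowsOn, hps]
          · rw [Equiv.swap_apply_of_ne_of_ne hkj hkp, Matrix.updateRow_ne hkj,
              Matrix.updateRow_ne hkj]
            have : (k : ℕ) ≠ p := fun h => hkp (Fin.ext h)
            simp [rowsOn, this]
      rw [hsw, Matrix.det_permute, Equiv.Perm.sign_swap (Ne.symm hpj)]
      simp [hps, hpj]
    · have : ((rowsOn N C s).updateRow j (Pi.single p 1)).det = 0 := by
        refine Matrix.det_zero_of_row_eq hpj ?_
        funext q
        rw [Matrix.updateRow_ne hpj, Matrix.updateRow_self]
        simp [rowsOn, hps]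
      simp [hpj, hps, this]

/-- The simultaneous induction, on the size of `s`, for the products of pairs and for those with
an unpaired `a_i` and an unpaired `b_j`. -/
theorem exp_eq_det_rowsOn (hω : ω 1 = 1) (ha : ∀ i, a i ∈ modeSpan ω a b) (m : ℕ) :
    ∀ s : Finset ℕ, s ⊆ Finset.range N → s.card ≤ m →
      ω (before (pairWord a b s) N) = (rowsOn N (fun i p => twoPoint ω b (a i) i p) s).det ∧
      ∀ i < N, ∀ j : Fin N, (j : ℕ) ∉ s → insertedExp ω a b N (a i) i j s =
        ((rowsOn N (fun i p => twoPoint ω b (a i) i p) s).updateRow j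
          fun p => twoPoint ω b (a i) i p).det := by
  induction m with
  | zero =>
    intro s hs hm
    obtain rfl : s = ∅ := Finset.card_eq_zero.1 (Nat.le_zero.1 hm)
    have h0 : ω (before (pairWord a b ∅) N) =
        (rowsOn N (fun i p => twoPoint ω b (a i) i p) ∅).det := by
      have h1 : before (pairWord a b ∅) N = 1 := by
        have h2 : pairWord a b ∅ = fun _ => 1 := funext fun l => by simp [pairWord]
        simp [before, h2]
      have h2 : rowsOn N (fun i p => twoPoint ω b (a i) i p) ∅ = 1 := by
        ext k p
        simp [rowsOn, Matrix.one_apply, Pi.single_apply, eq_comm]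
      rw [h1, h2, hω, Matrix.det_one]
    refine ⟨h0, fun i hi j hj => ?_⟩
    rw [insertedExp_eq hω (ha i) hj hi j.2, det_updateRow_rowsOn _ _ _ _ hj, h0]
    simp
  | succ m ih =>
    intro s hs hm
    have h0 : ω (before (pairWord a b s) N) =
        (rowsOn N (fun i p => twoPoint ω b (a i) i p) s).det := by
      rcases s.eq_empty_or_nonempty with rfl | ⟨k, hk⟩
      · exact (ih ∅ (by simp) (by simp)).1
      · have hkN : k < N := Finset.mem_range.1 (hs hk)
        have hcard : (s.erase k).card ≤ m := by
          rw [Finset.card_erase_of_mem hk]; omega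
        have h1 := (ih (s.erase k) ((Finset.erase_subset _ _).trans hs) hcard).2 k hkN ⟨k, hkN⟩
          (by simp)
        rw [← rowsOn_insert _ _ (⟨k, hkN⟩ : Fin N), Finset.insert_erase hk] at h1
        rw [← h1]
        unfold insertedExp
        simp only [orderSign, le_refl, if_true, one_mul]
        rw [← before_mul_after (pairWord a b s) hkN.le, after_of_lt _ hkN, after_of_lt _ hkN]
        have h2 : before (oddWord a b k (s.erase k)) k = before (pairWord a b s) k :=
          before_congr fun l hl => by simp [oddWord, pairWord, hl.ne]
        have h3 : after (oddWord a b k (s.erase k)) N (k + 1) =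
            after (pairWord a b s) N (k + 1) := by
          refine after_congr fun l hl _ => ?_
          have : l ≠ k := by omega
          simp [oddWord, pairWord, this]
        rw [h2, h3]
        simp [oddWord, pairWord, hk, mul_assoc]
    refine ⟨h0, fun i hi j hj => ?_⟩
    rw [insertedExp_eq hω (ha i) hj hi j.2, det_updateRow_rowsOn _ _ _ _ hj, h0,
      Finset.sum_range]
    congr 1
    refine Finset.sum_congr rfl fun p _ => ?_
    split_ifs with hp
    · have hcard : (s.erase p).card ≤ m := by
        rw [Finset.card_erase_of_mem hp]; omega
      rw [(ih (s.erase p) ((Finset.erase_subset _ _).trans hs) hcard).2 p p.2 j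
        fun h => hj (Finset.mem_of_mem_erase h)]
    · rfl

/-- **Wick's theorem** in determinant form, for a functional `ω` such that each `a_i` is a
combination of elements that are multiplied by a number `κ ≠ -1` when moved around `ω`. -/
theorem exp_ofFn_prod_eq_det (hω : ω 1 = 1) {N : ℕ} (a b : Fin N → A)
    (ha : ∀ i, a i ∈ Submodule.span ℂ {x | ∃ κ : ℂ, 1 + κ ≠ 0 ∧
      (∀ X, ω (X * x) = κ * ω (x * X)) ∧
      (∀ l, x * a l + a l * x = 0) ∧ ∀ l, ∃ c : ℂ, x * b l + b l * x = c • 1}) :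
    ω (List.ofFn fun i => a i * b i).prod =
      (Matrix.of fun i p : Fin N => if i ≤ p then ω (a i * b p) else -ω (b p * a i)).det := by
  -- continued by `0` to all natural numbers, where all hypotheses hold trivially
  let a' : ℕ → A := fun l => if h : l < N then a ⟨l, h⟩ else 0
  let b' : ℕ → A := fun l => if h : l < N then b ⟨l, h⟩ else 0
  have hset : Submodule.span ℂ {x | ∃ κ : ℂ, 1 + κ ≠ 0 ∧
      (∀ X, ω (X * x) = κ * ω (x * X)) ∧
      (∀ l, x * a l + a l * x = 0) ∧ ∀ l, ∃ c : ℂ, x * b l + b l * x = c • 1} ≤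
      modeSpan ω a' b' := by
    refine Submodule.span_mono ?_
    rintro x ⟨κ, hκ, hX, hxa, hxb⟩
    refine ⟨κ, hκ, hX, fun l => ?_, fun l => ?_⟩
    · by_cases h : l < N
      · simpa [a', h] using hxa ⟨l, h⟩
      · simp [a', h]
    · by_cases h : l < N
      · simpa [b', h] using hxb ⟨l, h⟩
      · exact ⟨0, by simp [b', h]⟩
  have ha' : ∀ i, a' i ∈ modeSpan ω a' b' := by
    intro i
    by_cases h : i < N
    · simpa [a', h] using hset (ha ⟨i, h⟩)
    · simp [a', h]
  have h := (exp_eq_det_rowsOn (N := N) hω ha' _ (Finset.range N) subset_rfl le_rfl).1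
  rw [before_eq_ofFn_prod] at h
  convert h using 2
  · congr 1
    refine congrArg _ (funext fun i => ?_)
    simp [pairWord, a', b']
  · ext i p
    simp [rowsOn, twoPoint, a', b']

end Wick

/-! ### Integrals over decreasing times -/

section OrderedSimplex

/-- The simplex `{r > s₀ > s₁ > ⋯ > s_{n - 1} ≥ 0}` of decreasing times. -/
def orderedSimplex (n : ℕ) (r : ℝ) : Set (Fin n → ℝ) :=
  {s | StrictAnti s ∧ ∀ i, s i ∈ Set.Ico 0 r}

theorem measurableSet_orderedSimplex (n : ℕ) (r : ℝ) : MeasurableSet (orderedSimplex n r) := by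
  have h : orderedSimplex n r = (⋂ i : Fin n, ⋂ j : Fin n, {s | i < j → s j < s i}) ∩
      ⋂ i : Fin n, {s | s i ∈ Set.Ico 0 r} := by
    ext s
    simp only [orderedSimplex, StrictAnti, Set.mem_ofPred_eq, Set.mem_inter_iff, Set.mem_iInter]
  rw [h]
  refine MeasurableSet.inter (MeasurableSet.iInter fun i => MeasurableSet.iInter fun j => ?_)
    (MeasurableSet.iInter fun i => (measurable_pi_apply i) measurableSet_Ico)
  by_cases hij : i < j
  · simp only [hij, true_imp_iff]
    exact measurableSet_lt (measurable_pi_apply j) (measurable_pi_apply i)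
  · simp [hij]

theorem orderedSimplex_subset_Icc (n : ℕ) (r : ℝ) :
    orderedSimplex n r ⊆ Set.Icc (0 : Fin n → ℝ) fun _ => r :=
  fun _ hs => ⟨fun i => (hs.2 i).1, fun i => (hs.2 i).2.le⟩

theorem cons_mem_orderedSimplex_iff {n : ℕ} {r a : ℝ} {s : Fin n → ℝ} :
    (Fin.cons a s : Fin (n + 1) → ℝ) ∈ orderedSimplex (n + 1) r ↔
      a ∈ Set.Ico 0 r ∧ s ∈ orderedSimplex n a := by
  constructor
  · rintro ⟨hanti, hmem⟩
    have ha : a ∈ Set.Ico 0 r := by simpa using hmem 0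
    refine ⟨ha, fun i j hij => ?_, fun i => ⟨?_, ?_⟩⟩
    · simpa using hanti (Fin.succ_lt_succ_iff.2 hij)
    · simpa using (hmem i.succ).1
    · simpa using hanti (Fin.succ_pos i)
  · rintro ⟨ha, hanti, hmem⟩
    refine ⟨fun i j hij => ?_, fun i => ?_⟩
    · revert hij
      refine Fin.cases ?_ (fun j => ?_) j
      · intro h; exact absurd h (Fin.not_lt_zero i)
      · refine Fin.cases ?_ (fun i => ?_) i
        · intro _; simpa using (hmem j).2
        · intro h; simpa using hanti (Fin.succ_lt_succ_iff.1 h)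
    · refine Fin.cases ?_ (fun i => ?_) i
      · simpa using ha
      · have := hmem i
        simp only [Fin.cons_succ]
        exact ⟨this.1, this.2.trans ha.2⟩

theorem setIntegral_orderedSimplex_succ {E : Type*} [NormedAddCommGroup E] [NormedSpace ℝ E]
    {n : ℕ} {r : ℝ} {f : (Fin (n + 1) → ℝ) → E}
    (hf : IntegrableOn f (orderedSimplex (n + 1) r)) :
    ∫ s in orderedSimplex (n + 1) r, f s =
      ∫ a in Set.Ico 0 r, ∫ s in orderedSimplex n a, f (Fin.cons a s) := by
  have hmp := (volume_preserving_piFinSuccAbove (fun _ : Fin (n + 1) => ℝ) 0).symm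
  have hsymm : ∀ p : ℝ × (Fin n → ℝ),
      (MeasurableEquiv.piFinSuccAbove (fun _ : Fin (n + 1) => ℝ) 0).symm p = Fin.cons p.1 p.2 := by
    intro p
    simp [MeasurableEquiv.piFinSuccAbove, Fin.insertNthEquiv]
  rw [← integral_indicator (measurableSet_orderedSimplex _ _), ← hmp.integral_comp',
    Measure.volume_eq_prod, integral_prod]
  · rw [← integral_indicator measurableSet_Ico]
    refine integral_congr_ae (Filter.Eventually.of_forall fun a => ?_)
    by_cases ha : a ∈ Set.Ico 0 r
    · simp only [Set.indicator_of_mem ha]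
      rw [← integral_indicator (measurableSet_orderedSimplex _ _)]
      refine integral_congr_ae (Filter.Eventually.of_forall fun s => ?_)
      by_cases hs : s ∈ orderedSimplex n a
      · simp only [hsymm, Set.indicator_of_mem hs]
        rw [Set.indicator_of_mem (cons_mem_orderedSimplex_iff.2 ⟨ha, hs⟩)]
      · simp only [hsymm, Set.indicator_of_notMem hs]
        rw [Set.indicator_of_notMem fun h => hs (cons_mem_orderedSimplex_iff.1 h).2]
    · simp only [Set.indicator_of_notMem ha, hsymm]
      refine (integral_congr_ae (Filter.Eventually.of_forall fun s => ?_)).trans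
        (integral_zero _ _)
      exact Set.indicator_of_notMem (fun h => ha (cons_mem_orderedSimplex_iff.1 h).1) f
  · rw [← Measure.volume_eq_prod]
    exact hmp.integrable_comp_of_integrable
      (hf.integrable_indicator (measurableSet_orderedSimplex _ _))

/-- Coinciding times form a null set, a proper linear subspace. -/
theorem volume_setOf_apply_eq_apply {n : ℕ} {i j : Fin n} (hij : i ≠ j) :
    volume {s : Fin n → ℝ | s i = s j} = 0 := by
  have h := Measure.addHaar_submodule (volume : Measure (Fin n → ℝ))
    (LinearMap.ker (LinearMap.proj (R := ℝ) (φ := fun _ : Fin n => ℝ) i -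
      LinearMap.proj (R := ℝ) (φ := fun _ : Fin n => ℝ) j)) ?_
  · convert h using 2
    ext s
    simp [sub_eq_zero]
  · intro htop
    have : (Pi.single i 1 : Fin n → ℝ) ∈ LinearMap.ker
        (LinearMap.proj (R := ℝ) (φ := fun _ : Fin n => ℝ) i -
          LinearMap.proj (R := ℝ) (φ := fun _ : Fin n => ℝ) j) := htop ▸ Submodule.mem_top
    simp [hij.symm] at this

/-- Up to a null set, the cube is the disjoint union of the images of the simplex of decreasing
times under the permutations of the coordinates. -/
theorem Icc_ae_eq_iUnion_orderedSimplex (n : ℕ) (r : ℝ) :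
    (Set.Icc (0 : Fin n → ℝ) fun _ => r) =ᵐ[volume]
      ⋃ π : Equiv.Perm (Fin n), {s | s ∘ π ∈ orderedSimplex n r} := by
  have h1 : (Set.Icc (0 : Fin n → ℝ) fun _ => r) =ᵐ[volume]
      (Set.univ.pi fun _ : Fin n => Set.Ico (0 : ℝ) r) :=
    (Measure.univ_pi_Ico_ae_eq_Icc (μ := fun _ : Fin n => (volume : Measure ℝ))
      (f := fun _ => 0) (g := fun _ => r)).symm
  have hinj : ∀ᵐ s : Fin n → ℝ, Function.Injective s := by
    have : ∀ i j : Fin n, i ≠ j → ∀ᵐ s : Fin n → ℝ, s i ≠ s j := by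
      intro i j hij
      rw [ae_iff]
      simpa using volume_setOf_apply_eq_apply hij
    have h2 : ∀ᵐ s : Fin n → ℝ, ∀ i j : Fin n, i ≠ j → s i ≠ s j := by
      rw [ae_all_iff]; intro i
      rw [ae_all_iff]; intro j
      by_cases hij : i = j
      · simp [hij]
      · simpa [hij] using this i j hij
    filter_upwards [h2] with s hs i j hij
    by_contra hne
    exact hs i j hne hij
  refine h1.trans ?_
  filter_upwards [hinj] with s hs
  refine propext ?_
  change s ∈ (Set.univ.pi fun _ : Fin n => Set.Ico (0 : ℝ) r) ↔
    s ∈ ⋃ π : Equiv.Perm (Fin n), {s | s ∘ π ∈ orderedSimplex n r}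
  simp only [Set.mem_pi, Set.mem_univ, true_imp_iff, Set.mem_iUnion, Set.mem_ofPred_eq]
  constructor
  · intro h
    refine ⟨Fin.revPerm.trans (Tuple.sort s), ?_, fun i => h _⟩
    have hm : StrictMono (s ∘ Tuple.sort s) :=
      (Tuple.monotone_sort s).strictMono_of_injective (hs.comp (Tuple.sort s).injective)
    intro i j hij
    exact hm (Fin.rev_lt_rev.2 hij)
  · rintro ⟨π, hπ⟩ i
    simpa using hπ.2 (π.symm i)

/-- The integral over the cube of a function that is symmetric in the times. -/
theorem setIntegral_Icc_eq_factorial_mul {n : ℕ} {r : ℝ} {f : (Fin n → ℝ) → ℂ}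
    (hf : IntegrableOn f (Set.Icc (0 : Fin n → ℝ) fun _ => r))
    (hsymm : ∀ (π : Equiv.Perm (Fin n)) s, f (s ∘ π) = f s) :
    ∫ s in Set.Icc (0 : Fin n → ℝ) (fun _ => r), f s =
      (n.factorial : ℂ) * ∫ s in orderedSimplex n r, f s := by
  have hmp : ∀ π : Equiv.Perm (Fin n),
      MeasurePreserving (MeasurableEquiv.piCongrLeft (fun _ : Fin n => ℝ) π.symm)
        volume volume := fun π => volume_measurePreserving_piCongrLeft (fun _ : Fin n => ℝ) π.symm
  have happ : ∀ (π : Equiv.Perm (Fin n)) (s : Fin n → ℝ),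
      MeasurableEquiv.piCongrLeft (fun _ : Fin n => ℝ) π.symm s = s ∘ π := by
    intro π s
    funext i
    have := MeasurableEquiv.piCongrLeft_apply_apply (β := fun _ : Fin n => ℝ) π.symm s (π i)
    simpa using this
  have hset : ∀ π : Equiv.Perm (Fin n), {s : Fin n → ℝ | s ∘ π ∈ orderedSimplex n r} =
      MeasurableEquiv.piCongrLeft (fun _ : Fin n => ℝ) π.symm ⁻¹' orderedSimplex n r := by
    intro π
    ext s
    simp [happ]
  have hmeas : ∀ π : Equiv.Perm (Fin n),
      MeasurableSet {s : Fin n → ℝ | s ∘ π ∈ orderedSimplex n r} := fun π => by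
    rw [hset]
    exact (MeasurableEquiv.measurable _) (measurableSet_orderedSimplex n r)
  have hdisj : Pairwise (Function.onFun Disjoint
      fun π : Equiv.Perm (Fin n) => {s : Fin n → ℝ | s ∘ π ∈ orderedSimplex n r}) := by
    intro π ρ hne
    refine Set.disjoint_left.2 fun s hπ hρ => hne ?_
    have h := Tuple.unique_antitone hπ.1.antitone hρ.1.antitone
    have hs : Function.Injective s := by
      have := hπ.1.injective.comp π.symm.injective
      simpa [Function.comp_assoc] using this
    exact Equiv.ext fun i => hs (congrFun h i)
  have hint : ∀ π : Equiv.Perm (Fin n), IntegrableOn f {s | s ∘ π ∈ orderedSimplex n r} :=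
    fun π => hf.mono_set fun s hs => ⟨fun i => by simpa using (hs.2 (π.symm i)).1,
      fun i => by simpa using (hs.2 (π.symm i)).2.le⟩
  rw [setIntegral_congr_set (Icc_ae_eq_iUnion_orderedSimplex n r),
    integral_iUnion_fintype hmeas hdisj hint]
  have heq : ∀ π : Equiv.Perm (Fin n), ∫ s in {s | s ∘ π ∈ orderedSimplex n r}, f s =
      ∫ s in orderedSimplex n r, f s := by
    intro π
    rw [hset]
    refine Eq.trans ?_
      ((hmp π).setIntegral_preimage_emb (MeasurableEquiv.measurableEmbedding _) f _)
    simp only [happ, hsymm]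
  simp [heq, Fintype.card_perm]

end OrderedSimplex

/-! ### The Dyson series -/

section Dyson

variable {𝔸 : Type*} [NormedRing 𝔸] [NormedAlgebra ℝ 𝔸]

/-- The iterates of the Volterra operator `f ↦ (r ↦ ∫₀ʳ V(s) f(s) ds)`, applied to `f`. -/
noncomputable def volterra (V f : ℝ → 𝔸) : ℕ → ℝ → 𝔸
  | 0 => f
  | n + 1 => fun r => ∫ s in (0 : ℝ)..r, V s * volterra V f n s

variable {V f : ℝ → 𝔸}

theorem continuous_volterra (hV : Continuous V) (hf : Continuous f) (n : ℕ) :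
    Continuous (volterra V f n) := by
  induction n with
  | zero => exact hf
  | succ n ih =>
    exact intervalIntegral.continuous_primitive
      (fun a b => (hV.mul ih).intervalIntegrable a b) 0

theorem norm_volterra_le {K M β : ℝ}
    (hK : ∀ s ∈ Set.Icc 0 β, ‖V s‖ ≤ K) (hM : ∀ s ∈ Set.Icc 0 β, ‖f s‖ ≤ M) (hK0 : 0 ≤ K)
    (n : ℕ) : ∀ r ∈ Set.Icc 0 β, ‖volterra V f n r‖ ≤ M * ((K * r) ^ n / n.factorial) := by
  induction n with
  | zero => intro r hr; simpa [volterra] using hM r hr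
  | succ n ih =>
    intro r hr
    have hcont : Continuous fun s : ℝ => K * (M * ((K * s) ^ n / n.factorial)) := by fun_prop
    have h1 : ‖volterra V f (n + 1) r‖ ≤
        ∫ s in (0 : ℝ)..r, K * (M * ((K * s) ^ n / n.factorial)) := by
      refine intervalIntegral.norm_integral_le_of_norm_le hr.1
        (Filter.Eventually.of_forall fun s hs => ?_) (hcont.intervalIntegrable _ _)
      have hs' : s ∈ Set.Icc 0 β := ⟨hs.1.le, hs.2.trans hr.2⟩
      exact (norm_mul_le _ _).trans
        (mul_le_mul (hK s hs') (ih s hs') (norm_nonneg _) hK0)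
    refine h1.trans (le_of_eq ?_)
    have h2 : ∀ s : ℝ, K * (M * ((K * s) ^ n / n.factorial)) =
        (K ^ (n + 1) * M / n.factorial) * s ^ n := by
      intro s
      rw [mul_pow]
      ring
    simp only [h2]
    rw [intervalIntegral.integral_const_mul, integral_pow, Nat.factorial_succ]
    have : ((n.factorial : ℕ) : ℝ) ≠ 0 := by exact_mod_cast n.factorial_ne_zero
    push_cast
    field_simp
    ring

/-- The Neumann series of the Volterra equation `W(r) = 1 - ∫₀ʳ V(s) W(s) ds`. -/
theorem hasSum_volterra [CompleteSpace 𝔸] {W : ℝ → 𝔸} (hV : Continuous V) (hW : Continuous W)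
    (h : ∀ r, W r = 1 - ∫ s in (0 : ℝ)..r, V s * W s) {β : ℝ} (hβ : 0 ≤ β) :
    HasSum (fun n => (-1 : ℝ) ^ n • volterra V (fun _ => 1) n β) (W β) := by
  obtain ⟨K, hK⟩ := (isCompact_Icc (a := (0 : ℝ)) (b := β)).exists_bound_of_continuousOn
    hV.continuousOn
  obtain ⟨M, hM⟩ := (isCompact_Icc (a := (0 : ℝ)) (b := β)).exists_bound_of_continuousOn
    hW.continuousOn
  have hK0 : 0 ≤ K := (norm_nonneg _).trans (hK 0 ⟨le_rfl, hβ⟩)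
  have hmem : β ∈ Set.Icc 0 β := ⟨hβ, le_rfl⟩
  have hstep : ∀ n r, volterra V W n r =
      volterra V (fun _ => 1) n r - volterra V W (n + 1) r := by
    intro n
    induction n with
    | zero => exact h
    | succ n ih =>
      intro r
      change (∫ s in (0 : ℝ)..r, V s * volterra V W n s) =
        (∫ s in (0 : ℝ)..r, V s * volterra V (fun _ => 1) n s) -
          ∫ s in (0 : ℝ)..r, V s * volterra V W (n + 1) s
      rw [← intervalIntegral.integral_sub (f := fun s => V s * volterra V (fun _ => 1) n s)
        (g := fun s => V s * volterra V W (n + 1) s)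
        ((hV.mul (continuous_volterra hV continuous_const n)).intervalIntegrable _ _)
        ((hV.mul (continuous_volterra hV hW (n + 1))).intervalIntegrable _ _)]
      simp only [← mul_sub, ← ih]
  have hpartial : ∀ n, ∑ k ∈ Finset.range n, (-1 : ℝ) ^ k • volterra V (fun _ => 1) k β =
      W β - (-1 : ℝ) ^ n • volterra V W n β := by
    intro n
    induction n with
    | zero => simp [volterra]
    | succ n ih =>
      rw [Finset.sum_range_succ, ih, hstep n β, pow_succ]
      simp only [smul_sub, mul_neg, mul_one, neg_smul]
      abel
  have hsummable : Summable fun n => ‖(-1 : ℝ) ^ n • volterra V (fun _ => (1 : 𝔸)) n β‖ := by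
    refine Summable.of_nonneg_of_le (fun _ => norm_nonneg _) (fun n => ?_)
      ((Real.summable_pow_div_factorial (K * β)).mul_left ‖(1 : 𝔸)‖)
    rw [norm_smul, norm_pow, norm_neg, norm_one, one_pow, one_mul]
    exact norm_volterra_le hK (fun _ _ => le_rfl) hK0 n β hmem
  rw [hasSum_iff_tendsto_nat_of_summable_norm hsummable]
  simp only [hpartial]
  have hzero : Filter.Tendsto (fun n => (-1 : ℝ) ^ n • volterra V W n β) Filter.atTop
      (nhds 0) := by
    refine squeeze_zero_norm (a := fun n => M * ((K * β) ^ n / n.factorial)) (fun n => ?_) ?_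
    · rw [norm_smul, norm_pow, norm_neg, norm_one, one_pow, one_mul]
      exact norm_volterra_le hK hM hK0 n β hmem
    · simpa using (FloorSemiring.tendsto_pow_div_factorial_atTop (K * β)).const_mul M
  simpa using (tendsto_const_nhds (x := W β)).sub hzero

theorem continuous_ofFn_prod {𝔸 : Type*} [NormedRing 𝔸] {V : ℝ → 𝔸} (hV : Continuous V) (n : ℕ) :
    Continuous fun s : Fin n → ℝ => (List.ofFn fun i => V (s i)).prod := by
  simp only [List.ofFn_eq_map]
  exact continuous_list_prod _ fun i _ => hV.comp (continuous_apply i)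

theorem integrableOn_ofFn_prod {𝔸 : Type*} [NormedRing 𝔸] {V : ℝ → 𝔸} (hV : Continuous V)
    (n : ℕ) (r : ℝ) :
    IntegrableOn (fun s : Fin n → ℝ => (List.ofFn fun i => V (s i)).prod)
      (orderedSimplex n r) :=
  ((continuous_ofFn_prod hV n).continuousOn.integrableOn_compact isCompact_Icc).mono_set
    (orderedSimplex_subset_Icc n r)

/-- The iterated integral as an integral over decreasing times. -/
theorem volterra_one_eq_setIntegral [CompleteSpace 𝔸] (hV : Continuous V) (n : ℕ) :
    ∀ r, 0 ≤ r → volterra V (fun _ => 1) n r =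
      ∫ s in orderedSimplex n r, (List.ofFn fun i => V (s i)).prod := by
  induction n with
  | zero =>
    intro r _
    have h : orderedSimplex 0 r = Set.univ := by
      ext s
      simp [orderedSimplex, StrictAnti]
    simp [volterra, h, Measure.real, volume_pi]
  | succ n ih =>
    intro r hr
    rw [setIntegral_orderedSimplex_succ (integrableOn_ofFn_prod hV (n + 1) r)]
    change ∫ s in (0 : ℝ)..r, V s * volterra V (fun _ => 1) n s = _
    rw [intervalIntegral.integral_of_le hr, ← integral_Ico_eq_integral_Ioc]
    refine setIntegral_congr_fun measurableSet_Ico fun a ha => ?_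
    simp only [List.ofFn_succ, List.prod_cons, Fin.cons_zero, Fin.cons_succ]
    rw [ih a ha.1, integral_const_mul_of_integrable]
    exact integrableOn_ofFn_prod hV n a

/-- The imaginary time evolution `s ↦ e^{sH} X e^{-sH}`. -/
noncomputable def heisenberg (H X : 𝔸) (s : ℝ) : 𝔸 :=
  NormedSpace.exp (s • H) * X * NormedSpace.exp (-(s • H))

theorem continuous_exp_smul [CompleteSpace 𝔸] (H : 𝔸) :
    Continuous fun s : ℝ => NormedSpace.exp (s • H) :=
  continuous_iff_continuousAt.2 fun s => (hasDerivAt_exp_smul_const H s).continuousAt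

theorem continuous_heisenberg [CompleteSpace 𝔸] (H X : 𝔸) : Continuous (heisenberg H X) := by
  unfold heisenberg
  have := continuous_exp_smul (-H)
  simp only [smul_neg] at this
  exact ((continuous_exp_smul H).mul continuous_const).mul this

/-- Duhamel's formula for `W(r) = e^{rH} e^{-r(H + X)}`. -/
theorem exp_mul_exp_eq_one_sub_integral [CompleteSpace 𝔸] (H X : 𝔸) (r : ℝ) :
    NormedSpace.exp (r • H) * NormedSpace.exp (-(r • (H + X))) = 1 -
      ∫ s in (0 : ℝ)..r, heisenberg H X s *
        (NormedSpace.exp (s • H) * NormedSpace.exp (-(s • (H + X)))) := by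
  have hcontW : Continuous fun s : ℝ =>
      NormedSpace.exp (s • H) * NormedSpace.exp (-(s • (H + X))) := by
    have := continuous_exp_smul (-(H + X))
    simp only [smul_neg] at this
    exact (continuous_exp_smul H).mul this
  have hd : ∀ s : ℝ, HasDerivAt
      (fun s : ℝ => NormedSpace.exp (s • H) * NormedSpace.exp (-(s • (H + X))))
      (-(heisenberg H X s *
        (NormedSpace.exp (s • H) * NormedSpace.exp (-(s • (H + X)))))) s := by
    intro s
    have h1 := hasDerivAt_exp_smul_const H s
    have h2 := hasDerivAt_exp_smul_const' (-(H + X)) s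
    simp only [smul_neg] at h2
    have h3 := h1.mul h2
    refine h3.congr_deriv ?_
    have h4 : NormedSpace.exp (-(s • H)) * NormedSpace.exp (s • H) = (1 : 𝔸) := by
      let _ : NormedAlgebra ℚ 𝔸 := NormedAlgebra.restrictScalars ℚ ℝ 𝔸
      rw [← NormedSpace.exp_add_of_commute (Commute.neg_left (Commute.refl _))]
      simp
    unfold heisenberg
    rw [mul_assoc _ (NormedSpace.exp (-(s • H))), ← mul_assoc (NormedSpace.exp (-(s • H))), h4]
    noncomm_ring
  have := intervalIntegral.integral_eq_sub_of_hasDerivAt (a := 0) (b := r)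
    (fun s _ => hd s)
    (((continuous_heisenberg H X).mul hcontW).neg.intervalIntegrable _ _)
  rw [intervalIntegral.integral_neg] at this
  simp only [zero_smul, neg_zero, NormedSpace.exp_zero, mul_one] at this
  rw [sub_eq_add_neg, this]
  abel

/-- The Dyson series of `e^{βH} e^{-β(H + X)}`. -/
theorem hasSum_dyson [CompleteSpace 𝔸] (H X : 𝔸) {β : ℝ} (hβ : 0 ≤ β) :
    HasSum (fun n => (-1 : ℝ) ^ n • ∫ s in orderedSimplex n β,
        (List.ofFn fun i => heisenberg H X (s i)).prod)
      (NormedSpace.exp (β • H) * NormedSpace.exp (-(β • (H + X)))) := by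
  have hcontW : Continuous fun s : ℝ =>
      NormedSpace.exp (s • H) * NormedSpace.exp (-(s • (H + X))) := by
    have := continuous_exp_smul (-(H + X))
    simp only [smul_neg] at this
    exact (continuous_exp_smul H).mul this
  have h := hasSum_volterra (continuous_heisenberg H X) hcontW
    (exp_mul_exp_eq_one_sub_integral H X) hβ
  simpa only [volterra_one_eq_setIntegral (continuous_heisenberg H X) _ β hβ] using h

end Dyson

/-! ### Imaginary time evolution -/

section Heisenberg

variable {𝔸 : Type*} [NormedRing 𝔸] [NormedAlgebra ℂ 𝔸]

theorem heisenberg_add (H X Y : 𝔸) (s : ℝ) :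
    heisenberg H (X + Y) s = heisenberg H X s + heisenberg H Y s := by
  simp [heisenberg, mul_add, add_mul]

theorem heisenberg_smul (H : 𝔸) (c : ℂ) (X : 𝔸) (s : ℝ) :
    heisenberg H (c • X) s = c • heisenberg H X s := by
  simp [heisenberg]

theorem heisenberg_sum (H : 𝔸) {ι : Type*} (t : Finset ι) (X : ι → 𝔸) (s : ℝ) :
    heisenberg H (∑ i ∈ t, X i) s = ∑ i ∈ t, heisenberg H (X i) s := by
  simp [heisenberg, Finset.mul_sum, Finset.sum_mul]

variable [CompleteSpace 𝔸]

theorem exp_mul_exp_neg (X : 𝔸) : NormedSpace.exp X * NormedSpace.exp (-X) = 1 := by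
  let _ : NormedAlgebra ℚ 𝔸 := NormedAlgebra.restrictScalars ℚ ℂ 𝔸
  rw [← NormedSpace.exp_add_of_commute (Commute.neg_right (Commute.refl X))]
  simp

theorem exp_neg_mul_exp (X : 𝔸) : NormedSpace.exp (-X) * NormedSpace.exp X = 1 := by
  simpa using exp_mul_exp_neg (-X)

theorem heisenberg_mul (H X Y : 𝔸) (s : ℝ) :
    heisenberg H (X * Y) s = heisenberg H X s * heisenberg H Y s := by
  have h := exp_neg_mul_exp (s • H)
  unfold heisenberg
  calc _ = NormedSpace.exp (s • H) * X * 1 * Y * NormedSpace.exp (-(s • H)) := by noncomm_ring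
    _ = _ := by rw [← h]; noncomm_ring

theorem heisenberg_one (H : 𝔸) (s : ℝ) : heisenberg H 1 s = 1 := by
  simp [heisenberg, exp_mul_exp_neg]

/-- The time evolution of an eigenvector of the commutator with `H`. -/
theorem heisenberg_eq_smul {H X : 𝔸} {E : ℝ} (h : H * X = X * H + (E : ℂ) • X) (s : ℝ) :
    heisenberg H X s = ((Real.exp (s * E) : ℝ) : ℂ) • X := by
  let _ : NormedAlgebra ℚ 𝔸 := NormedAlgebra.restrictScalars ℚ ℂ 𝔸
  have h1 : SemiconjBy X (s • H + algebraMap ℂ 𝔸 ((s * E : ℝ) : ℂ)) (s • H) := by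
    unfold SemiconjBy
    rw [mul_add, smul_mul_assoc, h, mul_smul_comm, smul_add, ← Algebra.commutes,
      ← Algebra.smul_def]
    congr 1
    push_cast
    rw [mul_smul, Complex.coe_smul s]
  have h2 := h1.exp_right
  have h3 : NormedSpace.exp (s • H + algebraMap ℂ 𝔸 ((s * E : ℝ) : ℂ)) =
      ((Real.exp (s * E) : ℝ) : ℂ) • NormedSpace.exp (s • H) := by
    rw [NormedSpace.exp_add_of_commute (Algebra.commutes _ _).symm,
      ← NormedSpace.algebraMap_exp_comm, ← Algebra.commutes, ← Algebra.smul_def,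
      ← Complex.exp_eq_exp_ℂ, Complex.ofReal_exp]
  unfold heisenberg
  rw [← h2.eq, h3, mul_smul_comm, smul_mul_assoc, mul_assoc, exp_mul_exp_neg, mul_one]

end Heisenberg

/-! ### The thermal expectation -/

section Trace

variable {S : Type} [Fintype S]

/-- The Fock space contains the vacuum. -/
theorem exists_fock_ne_zero (S : Type) [Fintype S] : ∃ φ : Fock S, φ ≠ 0 := by
  let v : FullFock S := WithLp.toLp 2 fun p => if (p.1 : ℕ) = 0 then 1 else 0
  have hv : v ∈ fockSpace S := by
    rw [mem_fockSpace_iff]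
    rintro ⟨n, hn⟩ x π
    cases n with
    | zero =>
      have : π = 1 := Subsingleton.elim _ _
      simp [v, this]
    | succ n => simp [v]
  refine ⟨(⟨v, hv⟩ : ↥(fockSpace S)), fun h => ?_⟩
  have h1 : v = 0 := congrArg Subtype.val h
  have h2 := congrArg (fun w : FullFock S => w ⟨⟨0, by omega⟩, Fin.elim0⟩) h1
  simp [v] at h2

theorem Tr_mul_comm (A B : Op S) : Tr (A * B) = Tr (B * A) :=
  LinearMap.trace_mul_comm ℂ (A : Fock S →ₗ[ℂ] Fock S) (B : Fock S →ₗ[ℂ] Fock S)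

/-- The trace is positive, being that of `B^* B` with the invertible `B = e^{-βH/2}`. -/
theorem Tr_exp_neg_ne_zero {H : Op S} (hH : star H = H) (β : ℝ) :
    Tr (NormedSpace.exp (-(β • H))) ≠ 0 := by
  let _ : NormedAlgebra ℚ (Op S) := NormedAlgebra.restrictScalars ℚ ℂ (Op S)
  set B : Op S := NormedSpace.exp (-((β / 2) • H)) with hB
  have hstar : star B = B := by
    rw [hB, NormedSpace.star_exp, star_neg, star_smul, hH]
    simp
  have hBB : NormedSpace.exp (-(β • H)) = star B * B := by
    rw [hstar, hB, ← NormedSpace.exp_add_of_commute (Commute.refl _), ← neg_add, ← add_smul]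
    norm_num
  have hsum : Tr (NormedSpace.exp (-(β • H))) =
      ((∑ i, ‖B (stdOrthonormalBasis ℂ (Fock S) i)‖ ^ 2 : ℝ) : ℂ) := by
    rw [Tr, LinearMap.trace_eq_sum_inner _ (stdOrthonormalBasis ℂ (Fock S)), hBB]
    push_cast
    refine Finset.sum_congr rfl fun i _ => ?_
    change inner ℂ _ (ContinuousLinearMap.adjoint B (B _)) = _
    rw [ContinuousLinearMap.adjoint_inner_right, inner_self_eq_norm_sq_to_K]
    rfl
  rw [hsum]
  intro h0
  rw [Complex.ofReal_eq_zero, Finset.sum_eq_zero_iff_of_nonneg fun i _ => by positivity] at h0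
  have hB0 : B = 0 := by
    have : (B : Fock S →ₗ[ℂ] Fock S) = 0 :=
      (stdOrthonormalBasis ℂ (Fock S)).toBasis.ext fun i => by
        simpa using h0 i (Finset.mem_univ i)
    exact ContinuousLinearMap.coe_injective this
  obtain ⟨φ, hφ⟩ := exists_fock_ne_zero S
  have h1 := exp_neg_mul_exp ((β / 2) • H)
  rw [← hB, hB0, zero_mul] at h1
  refine hφ ?_
  have := congrArg (fun A : Op S => A φ) h1
  simpa using this.symm

/-- The thermal expectation `A ↦ Tr (e^{-βH} A) / Tr e^{-βH}`. -/
noncomputable def thermal (H : Op S) (β : ℝ) : Op S →ₗ[ℂ] ℂ :=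
  (Tr (NormedSpace.exp (-(β • H))))⁻¹ • (LinearMap.trace ℂ (Fock S) ∘ₗ
    ContinuousLinearMap.coeLM ℂ ∘ₗ LinearMap.mulLeft ℂ (NormedSpace.exp (-(β • H))))

theorem thermal_apply (H : Op S) (β : ℝ) (A : Op S) :
    thermal H β A = Tr (NormedSpace.exp (-(β • H)) * A) / Tr (NormedSpace.exp (-(β • H))) := by
  rw [div_eq_inv_mul]
  rfl

theorem thermal_one {H : Op S} (hH : star H = H) (β : ℝ) : thermal H β 1 = 1 := by
  rw [thermal_apply, mul_one, div_self (Tr_exp_neg_ne_zero hH β)]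

/-- The KMS condition for an eigenvector of the commutator with `H`. -/
theorem thermal_mul_eq {H X : Op S} {E : ℝ} (h : H * X = X * H + (E : ℂ) • X) (β : ℝ)
    (A : Op S) : thermal H β (A * X) = ((Real.exp (β * E) : ℝ) : ℂ) * thermal H β (X * A) := by
  have h1 := heisenberg_eq_smul h β
  have h2 : X * NormedSpace.exp (-(β • H)) =
      ((Real.exp (β * E) : ℝ) : ℂ) • (NormedSpace.exp (-(β • H)) * X) := by
    rw [← mul_smul_comm, ← h1]
    unfold heisenberg
    rw [← mul_assoc, ← mul_assoc, exp_neg_mul_exp, one_mul]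
  have h3 : Tr (NormedSpace.exp (-(β • H)) * (A * X)) =
      ((Real.exp (β * E) : ℝ) : ℂ) * Tr (NormedSpace.exp (-(β • H)) * (X * A)) := by
    rw [← mul_assoc, Tr_mul_comm, ← mul_assoc, h2, smul_mul_assoc, mul_assoc]
    simp [Tr]
  rw [thermal_apply, thermal_apply, h3, mul_div_assoc]

end Trace

/-! ### Plane waves and the free Hamiltonian -/

section Modes

variable {d L : ℕ} [NeZero L]

/-- The character `x ↦ e^{i⟨k, x⟩}` of the lattice, for `k = 2π m / L`. -/
noncomputable def character (m x : Lattice d L) : ℂ := ∏ l, ZMod.stdAddChar (m l * x l)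

theorem exp_pairing (m x : Lattice d L) :
    Complex.exp (Complex.I * ((pairing m x : ℝ) : ℂ)) = character m x := by
  have h : ∀ l, ZMod.stdAddChar (m l * x l) = Complex.exp (Complex.I *
      ((2 * Real.pi * ((m l).val : ℝ) / (L : ℝ) * ((x l).val : ℝ) : ℝ) : ℂ)) := by
    intro l
    have h1 : m l * x l = (((m l).val * (x l).val : ℤ) : ZMod L) := by
      push_cast
      rw [ZMod.natCast_zmod_val, ZMod.natCast_zmod_val]
    rw [h1, ZMod.stdAddChar_coe]
    congr 1
    push_cast
    ring
  unfold character pairing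
  rw [Finset.prod_congr rfl fun l _ => h l, ← Complex.exp_sum, ← Finset.mul_sum]
  push_cast
  rfl

theorem character_add (m x y : Lattice d L) :
    character m (x + y) = character m x * character m y := by
  simp [character, mul_add, AddChar.map_add_eq_mul, Finset.prod_mul_distrib]

theorem character_zero (m : Lattice d L) : character m 0 = 1 := by
  simp [character]

theorem character_mul_neg (m x : Lattice d L) : character m x * character m (-x) = 1 := by
  rw [← character_add, add_neg_cancel, character_zero]

theorem sum_character (x : Lattice d L) :
    ∑ m : Lattice d L, character m x = if x = 0 then (L : ℂ) ^ d else 0 := by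
  have h : ∀ l, ∑ k : ZMod L, ZMod.stdAddChar (k * x l) = if x l = 0 then (L : ℂ) else 0 := by
    intro l
    rw [AddChar.sum_mulShift (x l) (ZMod.isPrimitive_stdAddChar L)]
    split_ifs <;> simp
  unfold character
  have h2 := Finset.prod_univ_sum (fun _ : Fin d => (Finset.univ : Finset (ZMod L)))
    (fun l k => ZMod.stdAddChar (k * x l))
  rw [Fintype.piFinset_univ] at h2
  rw [← h2, Finset.prod_congr rfl fun l _ => h l]
  split_ifs with hx
  · simp [hx]
  · obtain ⟨l, hl⟩ := Function.ne_iff.1 hx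
    exact Finset.prod_eq_zero (Finset.mem_univ l) (if_neg hl)

theorem character_unitVec_add_neg (m : Lattice d L) (j : Fin d) :
    character m (unitVec j) + character m (-unitVec j) =
      2 * ((Real.cos (pairing m (unitVec j)) : ℝ) : ℂ) := by
  have h1 : character m (-unitVec j) =
      Complex.exp (-(((pairing m (unitVec j) : ℝ) : ℂ) * Complex.I)) := by
    rw [Complex.exp_neg, mul_comm _ Complex.I, exp_pairing]
    exact eq_inv_of_mul_eq_one_right (character_mul_neg m _)
  rw [h1, ← exp_pairing, Complex.ofReal_cos, Complex.cos, mul_comm Complex.I, neg_mul]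
  ring

theorem sum_kron_mul_character (m x v : Lattice d L) :
    ∑ z : Lattice d L, ((kron x (z + v) : ℝ) : ℂ) * character m z =
      character m x * character m (-v) := by
  rw [Finset.sum_eq_single (x + -v)]
  · simp [kron, character_add]
  · intro z _ hz
    have : x ≠ z + v := fun h => hz (by rw [h]; abel)
    simp [kron, this]
  · simp

/-- The plane waves diagonalize the hopping matrix. -/
theorem sum_hopping_mul_character (t t' μ : ℝ) (m x : Lattice d L) (σ : Spin) :
    ∑ z : Lattice d L, ((hopping t t' μ (x, σ) (z, σ) : ℝ) : ℂ) * character m z =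
      ((dispersion t t' μ m : ℝ) : ℂ) * character m x := by
  have h1 : ∀ j : Fin d, ∑ z : Lattice d L, (((kron x (z - unitVec j) : ℝ) : ℂ) +
      ((kron x (z + unitVec j) : ℝ) : ℂ)) * character m z =
      2 * ((Real.cos (pairing m (unitVec j)) : ℝ) : ℂ) * character m x := by
    intro j
    simp only [add_mul, Finset.sum_add_distrib, sub_eq_add_neg, sum_kron_mul_character, neg_neg]
    rw [← character_unitVec_add_neg]
    ring
  have h2 : ∀ j k : Fin d, ∑ z : Lattice d L,
      (((kron x (z - unitVec j - unitVec k) : ℝ) : ℂ) +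
        ((kron x (z - unitVec j + unitVec k) : ℝ) : ℂ) +
        ((kron x (z + unitVec j - unitVec k) : ℝ) : ℂ) +
        ((kron x (z + unitVec j + unitVec k) : ℝ) : ℂ)) * character m z =
      4 * ((Real.cos (pairing m (unitVec j)) : ℝ) : ℂ) *
        ((Real.cos (pairing m (unitVec k)) : ℝ) : ℂ) * character m x := by
    intro j k
    simp only [add_mul, Finset.sum_add_distrib, sub_eq_add_neg, add_assoc,
      sum_kron_mul_character, neg_add, neg_neg, character_add]
    have hj := character_unitVec_add_neg m j
    have hk := character_unitVec_add_neg m k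
    linear_combination
      character m x * (character m (unitVec k) + character m (-unitVec k)) * hj +
      2 * ((Real.cos (pairing m (unitVec j)) : ℝ) : ℂ) * character m x * hk
  have h3 : ∑ z : Lattice d L, ((kron x z : ℝ) : ℂ) * character m z = character m x := by
    simpa [character_zero] using sum_kron_mul_character m x 0
  have h4 : ∑ z : Lattice d L, (∑ j : Fin d, (((kron x (z - unitVec j) : ℝ) : ℂ) +
      ((kron x (z + unitVec j) : ℝ) : ℂ))) * character m z =
      2 * (∑ j : Fin d, ((Real.cos (pairing m (unitVec j)) : ℝ) : ℂ)) * character m x := by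
    simp only [Finset.sum_mul]
    rw [Finset.sum_comm]
    simp only [Finset.sum_mul, h1, Finset.mul_sum]
  have h5 : ∑ z : Lattice d L, (∑ j : Fin d, ∑ k : Fin d, if j < k then
      (((kron x (z - unitVec j - unitVec k) : ℝ) : ℂ) +
        ((kron x (z - unitVec j + unitVec k) : ℝ) : ℂ) +
        ((kron x (z + unitVec j - unitVec k) : ℝ) : ℂ) +
        ((kron x (z + unitVec j + unitVec k) : ℝ) : ℂ)) else 0) * character m z =
      4 * (∑ j : Fin d, ∑ k : Fin d, if j < k then
        ((Real.cos (pairing m (unitVec j)) : ℝ) : ℂ) *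
          ((Real.cos (pairing m (unitVec k)) : ℝ) : ℂ) else 0) * character m x := by
    simp only [Finset.sum_mul]
    rw [Finset.sum_comm]
    simp only [Finset.sum_mul, Finset.mul_sum]
    refine Finset.sum_congr rfl fun j _ => ?_
    rw [Finset.sum_comm]
    refine Finset.sum_congr rfl fun k _ => ?_
    split_ifs
    · rw [h2]; ring
    · simp
  have h6 : ∀ z : Lattice d L, ((hopping t t' μ (x, σ) (z, σ) : ℝ) : ℂ) * character m z =
      -t * ((∑ j : Fin d, (((kron x (z - unitVec j) : ℝ) : ℂ) +
        ((kron x (z + unitVec j) : ℝ) : ℂ))) * character m z) -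
      t' * ((if 2 ≤ d then 1 else 0 : ℝ) : ℂ) * ((∑ j : Fin d, ∑ k : Fin d, if j < k then
        (((kron x (z - unitVec j - unitVec k) : ℝ) : ℂ) +
        ((kron x (z - unitVec j + unitVec k) : ℝ) : ℂ) +
        ((kron x (z + unitVec j - unitVec k) : ℝ) : ℂ) +
        ((kron x (z + unitVec j + unitVec k) : ℝ) : ℂ)) else 0) * character m z) -
      μ * (((kron x z : ℝ) : ℂ) * character m z) := by
    intro z
    simp only [hopping]
    have : kron σ σ = 1 := by simp [kron]
    rw [this]
    push_cast [apply_ite Complex.ofReal]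
    ring
  simp only [h6, Finset.sum_sub_distrib, ← Finset.mul_sum, h3, h4, h5]
  unfold dispersion
  push_cast [apply_ite Complex.ofReal]
  ring

/-- The creation operator of a particle with the momentum `k = 2π m / L`, up to normalization. -/
noncomputable def createMode (m : Lattice d L) (σ : Spin) : Op (Lattice d L × Spin) :=
  ∑ z : Lattice d L, character m z • create (z, σ)

theorem create_eq_sum_createMode (x : Lattice d L) (σ : Spin) :
    create (x, σ) = ((L : ℂ) ^ d)⁻¹ • ∑ m : Lattice d L, character m (-x) • createMode m σ := by
  have hL : (L : ℂ) ^ d ≠ 0 := pow_ne_zero _ (NeZero.ne _)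
  unfold createMode
  simp only [Finset.smul_sum, smul_smul]
  rw [Finset.sum_comm]
  simp only [← Finset.sum_smul, ← Finset.mul_sum, ← character_add, sum_character]
  rw [Finset.sum_eq_single x]
  · simp [hL]
  · intro z _ hz
    have : -x + z ≠ 0 := fun h => hz (neg_add_eq_zero.1 h).symm
    simp [this]
  · simp

theorem freeHamiltonian_mul_create (t t' μ : ℝ) (Z : Lattice d L × Spin) :
    freeHamiltonian d L t t' μ * create Z = create Z * freeHamiltonian d L t t' μ +
      ∑ X, ((hopping t t' μ X Z : ℝ) : ℂ) • create X := by
  have h : ∀ X Y : Lattice d L × Spin, create X * annihilate Y * create Z =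
      create Z * (create X * annihilate Y) + (if Y = Z then (1 : ℂ) else 0) • create X := by
    intro X Y
    have h1 := annihilate_create_anticomm Y Z
    have h2 := create_create_anticomm X Z
    rw [mul_assoc, eq_sub_of_add_eq h1, mul_sub, ← mul_assoc, ← mul_assoc,
      eq_neg_of_add_eq_zero_left h2, mul_smul_comm, mul_one]
    rw [neg_mul, sub_neg_eq_add, add_comm]
  unfold freeHamiltonian
  simp only [Finset.sum_mul, Finset.mul_sum, smul_mul_assoc, mul_smul_comm, h, smul_add,
    Finset.sum_add_distrib]
  congr 1
  refine Finset.sum_congr rfl fun X _ => ?_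
  simp

theorem freeHamiltonian_mul_createMode (t t' μ : ℝ) (m : Lattice d L) (σ : Spin) :
    freeHamiltonian d L t t' μ * createMode m σ = createMode m σ * freeHamiltonian d L t t' μ +
      ((dispersion t t' μ m : ℝ) : ℂ) • createMode m σ := by
  unfold createMode
  simp only [Finset.sum_mul, Finset.mul_sum, smul_mul_assoc, mul_smul_comm,
    freeHamiltonian_mul_create, smul_add, Finset.sum_add_distrib]
  congr 1
  have h : ∀ (z : Lattice d L), ∑ X : Lattice d L × Spin,
      ((hopping t t' μ X (z, σ) : ℝ) : ℂ) • create X =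
      ∑ x : Lattice d L, ((hopping t t' μ (x, σ) (z, σ) : ℝ) : ℂ) • create (x, σ) := by
    intro z
    rw [Fintype.sum_prod_type]
    refine Finset.sum_congr rfl fun x _ => ?_
    rw [Finset.sum_eq_single σ]
    · intro τ _ hτ
      simp [hopping, kron, hτ]
    · simp
  simp only [h, Finset.smul_sum, smul_smul]
  rw [Finset.sum_comm]
  refine Finset.sum_congr rfl fun x _ => ?_
  rw [← Finset.sum_smul, ← sum_hopping_mul_character t t' μ m x σ]
  simp only [mul_comm]

theorem createMode_mul_create (m : Lattice d L) (σ : Spin) (Z : Lattice d L × Spin) :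
    createMode m σ * create Z + create Z * createMode m σ = 0 := by
  unfold createMode
  rw [Finset.sum_mul, Finset.mul_sum, ← Finset.sum_add_distrib]
  refine Finset.sum_eq_zero fun z _ => ?_
  rw [smul_mul_assoc, mul_smul_comm, ← smul_add, create_create_anticomm, smul_zero]

theorem createMode_mul_annihilate (m : Lattice d L) (σ : Spin) (Y : Lattice d L × Spin) :
    createMode m σ * annihilate Y + annihilate Y * createMode m σ =
      (((kron σ Y.2 : ℝ) : ℂ) * character m Y.1) • 1 := by
  unfold createMode
  rw [Finset.sum_mul, Finset.mul_sum, ← Finset.sum_add_distrib]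
  have h : ∀ z, character m z • create (z, σ) * annihilate Y +
      annihilate Y * character m z • create (z, σ) =
      (character m z * if Y = (z, σ) then (1 : ℂ) else 0) • (1 : Op (Lattice d L × Spin)) := by
    intro z
    rw [smul_mul_assoc, mul_smul_comm, ← smul_add, add_comm, annihilate_create_anticomm,
      smul_smul]
  simp only [h, ← Finset.sum_smul]
  congr 1
  obtain ⟨y, τ⟩ := Y
  by_cases hs : τ = σ
  · subst hs
    simp [kron, Prod.ext_iff]
  · simp [kron, Prod.ext_iff, hs, Ne.symm hs]

theorem hopping_comm {d L : ℕ} (t t' μ : ℝ) (X Y : Lattice d L × Spin) :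
    hopping t t' μ X Y = hopping t t' μ Y X := by
  have hk : ∀ {A : Type} [DecidableEq A] (a b : A), kron a b = kron b a := by
    intro A _ a b
    simp [kron, eq_comm]
  have h : ∀ {x y a b : Lattice d L}, a + b = x + y → kron x a = kron y b := by
    intro x y a b hab
    have : x = a ↔ y = b :=
      ⟨fun h => (add_left_cancel (h ▸ hab)).symm, fun h => (add_right_cancel (h ▸ hab)).symm⟩
    simp [kron, this]
  have hpair : ∀ u v : Lattice d L,
      kron X.1 (Y.1 - u - v) + kron X.1 (Y.1 - u + v) + kron X.1 (Y.1 + u - v) +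
        kron X.1 (Y.1 + u + v) =
      kron Y.1 (X.1 - u - v) + kron Y.1 (X.1 - u + v) + kron Y.1 (X.1 + u - v) +
        kron Y.1 (X.1 + u + v) := by
    intro u v
    rw [h (show (Y.1 - u - v) + (X.1 + u + v) = X.1 + Y.1 by abel),
      h (show (Y.1 - u + v) + (X.1 + u - v) = X.1 + Y.1 by abel),
      h (show (Y.1 + u - v) + (X.1 - u + v) = X.1 + Y.1 by abel),
      h (show (Y.1 + u + v) + (X.1 - u - v) = X.1 + Y.1 by abel)]
    ring
  have hsingle : ∀ u : Lattice d L, kron X.1 (Y.1 - u) + kron X.1 (Y.1 + u) =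
      kron Y.1 (X.1 - u) + kron Y.1 (X.1 + u) := by
    intro u
    rw [h (show (Y.1 - u) + (X.1 + u) = X.1 + Y.1 by abel),
      h (show (Y.1 + u) + (X.1 - u) = X.1 + Y.1 by abel), add_comm]
  unfold hopping
  simp only [hpair, hsingle, hk X.2, hk X.1 Y.1]

theorem star_freeHamiltonian (t t' μ : ℝ) :
    star (freeHamiltonian d L t t' μ) = freeHamiltonian d L t t' μ := by
  have h1 : ∀ X : Lattice d L × Spin, star (create X) = annihilate X := fun X => by
    rw [create, ← ContinuousLinearMap.star_eq_adjoint, star_star]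
  have h2 : ∀ X : Lattice d L × Spin, star (annihilate X) = create X := fun X => by
    rw [create, ← ContinuousLinearMap.star_eq_adjoint]
  unfold freeHamiltonian
  simp only [star_sum, star_smul, star_mul, h1, h2, Complex.star_def, Complex.conj_ofReal]
  rw [Finset.sum_comm]
  simp only [hopping_comm t t' μ]

end Modes

/-! ### The covariance as the free two-point function -/

section Covariance

variable {d L : ℕ} [NeZero L] (t t' μ β : ℝ)

/-- The creation operator at the imaginary time `s`. -/
noncomputable def createAt (X : Lattice d L × Spin) (s : ℝ) : Op (Lattice d L × Spin) :=
  heisenberg (freeHamiltonian d L t t' μ) (create X) s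

/-- The annihilation operator at the imaginary time `s`. -/
noncomputable def annihilateAt (X : Lattice d L × Spin) (s : ℝ) : Op (Lattice d L × Spin) :=
  heisenberg (freeHamiltonian d L t t' μ) (annihilate X) s

/-- The thermal expectation of the free system. -/
noncomputable def freeExp : Op (Lattice d L × Spin) →ₗ[ℂ] ℂ :=
  thermal (freeHamiltonian d L t t' μ) β

theorem heisenberg_createMode (m : Lattice d L) (σ : Spin) (s : ℝ) :
    heisenberg (freeHamiltonian d L t t' μ) (createMode m σ) s =
      ((Real.exp (s * dispersion t t' μ m) : ℝ) : ℂ) • createMode m σ :=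
  heisenberg_eq_smul (freeHamiltonian_mul_createMode t t' μ m σ) s

theorem createMode_eq_smul_heisenberg (m : Lattice d L) (σ : Spin) (s : ℝ) :
    createMode m σ = ((Real.exp (-(s * dispersion t t' μ m)) : ℝ) : ℂ) •
      heisenberg (freeHamiltonian d L t t' μ) (createMode m σ) s := by
  rw [heisenberg_createMode, smul_smul, ← Complex.ofReal_mul, ← Real.exp_add]
  simp

theorem createMode_mul_createAt (m : Lattice d L) (σ : Spin) (Z : Lattice d L × Spin) (s : ℝ) :
    createMode m σ * createAt t t' μ Z s + createAt t t' μ Z s * createMode m σ = 0 := by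
  rw [createMode_eq_smul_heisenberg t t' μ m σ s, createAt, smul_mul_assoc, mul_smul_comm,
    ← smul_add, ← heisenberg_mul, ← heisenberg_mul, ← heisenberg_add, createMode_mul_create]
  simp [heisenberg]

theorem createMode_mul_annihilateAt (m : Lattice d L) (σ : Spin) (Y : Lattice d L × Spin)
    (s : ℝ) :
    createMode m σ * annihilateAt t t' μ Y s + annihilateAt t t' μ Y s * createMode m σ =
      (((Real.exp (-(s * dispersion t t' μ m)) : ℝ) : ℂ) *
        (((kron σ Y.2 : ℝ) : ℂ) * character m Y.1)) • 1 := by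
  rw [createMode_eq_smul_heisenberg t t' μ m σ s, annihilateAt, smul_mul_assoc, mul_smul_comm,
    ← smul_add, ← heisenberg_mul, ← heisenberg_mul, ← heisenberg_add, createMode_mul_annihilate,
    heisenberg_smul, heisenberg_one, smul_smul]

theorem createAt_eq_sum (x : Lattice d L) (σ : Spin) (s : ℝ) :
    createAt t t' μ (x, σ) s = ∑ m : Lattice d L, (((L : ℂ) ^ d)⁻¹ * character m (-x) *
      ((Real.exp (s * dispersion t t' μ m) : ℝ) : ℂ)) • createMode m σ := by
  rw [createAt, create_eq_sum_createMode, heisenberg_smul, heisenberg_sum, Finset.smul_sum]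
  refine Finset.sum_congr rfl fun m _ => ?_
  rw [heisenberg_smul, heisenberg_createMode, smul_smul, smul_smul, mul_assoc]

theorem one_add_exp_ne_zero (r : ℝ) : (1 : ℂ) + ((Real.exp r : ℝ) : ℂ) ≠ 0 := by
  have : (0 : ℝ) < 1 + Real.exp r := by positivity
  exact_mod_cast this.ne'

theorem freeExp_one : freeExp t t' μ β (1 : Op (Lattice d L × Spin)) = 1 :=
  thermal_one (star_freeHamiltonian t t' μ) β

theorem freeExp_mul_createMode (m : Lattice d L) (σ : Spin) (A : Op (Lattice d L × Spin)) :
    freeExp t t' μ β (A * createMode m σ) =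
      ((Real.exp (β * dispersion t t' μ m) : ℝ) : ℂ) *
        freeExp t t' μ β (createMode m σ * A) :=
  thermal_mul_eq (freeHamiltonian_mul_createMode t t' μ m σ) β A

theorem freeExp_createMode_mul_annihilateAt (m : Lattice d L) (σ : Spin)
    (Y : Lattice d L × Spin) (s : ℝ) :
    freeExp t t' μ β (createMode m σ * annihilateAt t t' μ Y s) =
      ((Real.exp (-(s * dispersion t t' μ m)) : ℝ) : ℂ) *
        (((kron σ Y.2 : ℝ) : ℂ) * character m Y.1) /
          (1 + ((Real.exp (β * dispersion t t' μ m) : ℝ) : ℂ)) := by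
  have h := congrArg (freeExp t t' μ β) (createMode_mul_annihilateAt t t' μ m σ Y s)
  rw [map_add, freeExp_mul_createMode, map_smul, freeExp_one, smul_eq_mul, mul_one] at h
  rw [eq_div_iff (one_add_exp_ne_zero _), ← h]
  ring

/-- The two-point function at `b ≤ a`, including equal times, where the creation operator stands
to the left. -/
theorem freeExp_createAt_mul_annihilateAt (X Y : Lattice d L × Spin) {a b : ℝ} (h : b ≤ a) :
    freeExp t t' μ β (createAt t t' μ X a * annihilateAt t t' μ Y b) =
      covariance t t' μ β X a Y b := by
  obtain ⟨x, σ⟩ := X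
  have h1 : b - a ≤ 0 := by linarith
  have h2 : ¬ 0 < b - a := by linarith
  rw [createAt_eq_sum, Finset.sum_mul, map_sum, covariance, Finset.mul_sum]
  refine Finset.sum_congr rfl fun m _ => ?_
  rw [smul_mul_assoc, map_smul, freeExp_createMode_mul_annihilateAt, exp_pairing,
    sub_eq_add_neg Y.1, character_add, if_pos h1, if_neg h2]
  have h3 : -(b - a) * dispersion t t' μ m =
      a * dispersion t t' μ m + -(b * dispersion t t' μ m) := by ring
  rw [h3, Real.exp_add]
  push_cast
  rw [smul_eq_mul]
  ring

theorem neg_freeExp_annihilateAt_mul_createAt (X Y : Lattice d L × Spin) {a b : ℝ} (h : a < b) :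
    -freeExp t t' μ β (annihilateAt t t' μ Y b * createAt t t' μ X a) =
      covariance t t' μ β X a Y b := by
  obtain ⟨x, σ⟩ := X
  have h1 : ¬ b - a ≤ 0 := by linarith
  have h2 : 0 < b - a := by linarith
  rw [createAt_eq_sum, Finset.mul_sum, map_sum, covariance, Finset.mul_sum,
    ← Finset.sum_neg_distrib]
  refine Finset.sum_congr rfl fun m _ => ?_
  rw [mul_smul_comm, map_smul, freeExp_mul_createMode, freeExp_createMode_mul_annihilateAt,
    exp_pairing, sub_eq_add_neg Y.1, character_add, if_neg h1, if_pos h2]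
  have h3 : -(b - a) * dispersion t t' μ m =
      a * dispersion t t' μ m + -(b * dispersion t t' μ m) := by ring
  have h4 : ((Real.exp (β * dispersion t t' μ m) : ℝ) : ℂ) /
      (1 + ((Real.exp (β * dispersion t t' μ m) : ℝ) : ℂ)) =
      1 / (1 + ((Real.exp (-β * dispersion t t' μ m) : ℝ) : ℂ)) := by
    rw [div_eq_div_iff (one_add_exp_ne_zero _) (one_add_exp_ne_zero _), mul_add, mul_one, one_mul,
      ← Complex.ofReal_mul, ← Real.exp_add]
    simp [add_comm]
  rw [h3, Real.exp_add]
  push_cast at h4 ⊢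
  rw [smul_eq_mul]
  linear_combination (-((L : ℂ) ^ d)⁻¹ * character m (-x) *
    Complex.exp (a * dispersion t t' μ m) * Complex.exp (-(b * dispersion t t' μ m)) *
      kron σ Y.2 * character m Y.1) * h4

theorem freeExp_annihilateAt_mul_createAt_of_ne (X Y : Lattice d L × Spin) (a b : ℝ)
    (h : X.2 ≠ Y.2) :
    freeExp t t' μ β (annihilateAt t t' μ Y b * createAt t t' μ X a) = 0 := by
  obtain ⟨x, σ⟩ := X
  rw [createAt_eq_sum, Finset.mul_sum, map_sum]
  refine Finset.sum_eq_zero fun m _ => ?_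
  rw [mul_smul_comm, map_smul, freeExp_mul_createMode, freeExp_createMode_mul_annihilateAt]
  have : kron σ Y.2 = 0 := if_neg h
  simp [this]

/-- Wick's theorem for the free system. The operators are ordered as they are written; the time
arguments are arbitrary. -/
theorem freeExp_ofFn_prod {N : ℕ} (X Y : Fin N → Lattice d L × Spin) (s : Fin N → ℝ) :
    freeExp t t' μ β
        (List.ofFn fun i => createAt t t' μ (X i) (s i) * annihilateAt t t' μ (Y i) (s i)).prod =
      (Matrix.of fun i p : Fin N => if i ≤ p then
        freeExp t t' μ β (createAt t t' μ (X i) (s i) * annihilateAt t t' μ (Y p) (s p)) else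
        -freeExp t t' μ β
          (annihilateAt t t' μ (Y p) (s p) * createAt t t' μ (X i) (s i))).det := by
  refine exp_ofFn_prod_eq_det (freeExp_one t t' μ β)
    (fun i => createAt t t' μ (X i) (s i)) (fun i => annihilateAt t t' μ (Y i) (s i)) fun i => ?_
  change createAt t t' μ ((X i).1, (X i).2) (s i) ∈ _
  rw [createAt_eq_sum]
  refine Submodule.sum_mem _ fun m _ => Submodule.smul_mem _ _ (Submodule.subset_span ?_)
  exact ⟨_, one_add_exp_ne_zero (β * dispersion t t' μ m), freeExp_mul_createMode t t' μ β m _,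
    fun l => createMode_mul_createAt t t' μ m _ _ _,
    fun l => ⟨_, createMode_mul_annihilateAt t t' μ m _ _ _⟩⟩

/-- For decreasing times the expectation of the product of the pairs is the determinant of
covariances. Within a pair the two spins differ, so that the order of the two operators at equal
times is immaterial. -/
theorem freeExp_ofFn_prod_eq_covarianceDet {n : ℕ} (x y : Fin (2 * n) → Lattice d L)
    (σ : Fin (2 * n) → Spin) (hσ : ∀ j : Fin n, σ (fstIdx j) ≠ σ (sndIdx j)) {s : Fin n → ℝ}
    (hs : StrictAnti s) :
    freeExp t t' μ β (List.ofFn fun i : Fin (2 * n) =>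
        createAt t t' μ (x i, σ i) (s (pairIdx i)) *
          annihilateAt t t' μ (y i, σ i) (s (pairIdx i))).prod =
      covarianceDet t t' μ β x y σ s := by
  rw [freeExp_ofFn_prod t t' μ β (fun i => (x i, σ i)) (fun i => (y i, σ i))
    (fun i => s (pairIdx i)), covarianceDet]
  congr 1
  ext i p
  simp only [Matrix.of_apply]
  split_ifs with hip
  · refine freeExp_createAt_mul_annihilateAt t t' μ β _ _ (hs.antitone ?_)
    rw [Fin.le_def] at hip ⊢
    exact Nat.div_le_div_right hip
  · rw [Fin.le_def, not_le] at hip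
    have hle : (p : ℕ) / 2 ≤ (i : ℕ) / 2 := Nat.div_le_div_right hip.le
    rcases hle.lt_or_eq with hlt | heq
    · exact neg_freeExp_annihilateAt_mul_createAt t t' μ β _ _ (hs (Fin.lt_def.2 hlt))
    · have hp : p = fstIdx (pairIdx i) := Fin.ext (by simp [fstIdx, pairIdx]; omega)
      have hi : i = sndIdx (pairIdx i) := Fin.ext (by simp [sndIdx, pairIdx]; omega)
      have hne : σ i ≠ σ p := by
        have := hσ (pairIdx i)
        rw [← hp, ← hi] at this
        exact this.symm
      rw [freeExp_annihilateAt_mul_createAt_of_ne t t' μ β _ _ _ _ hne]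
      have : kron (σ i) (σ p) = 0 := if_neg hne
      simp [covariance, this]

theorem measurable_covariance (X Y : Lattice d L × Spin) {α : Type*} [MeasurableSpace α]
    {f g : α → ℝ} (hf : Measurable f) (hg : Measurable g) :
    Measurable fun q => covariance t t' μ β X (f q) Y (g q) := by
  have h1 : MeasurableSet {q | g q - f q ≤ 0} := measurableSet_le (hg.sub hf) measurable_const
  have h2 : MeasurableSet {q | 0 < g q - f q} := measurableSet_lt measurable_const (hg.sub hf)
  unfold covariance
  refine Measurable.const_mul (Finset.measurable_sum _ fun m _ => Measurable.const_mul
    (Complex.measurable_ofReal.comp (Measurable.mul (by fun_prop) ?_)) _) _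
  exact ((Measurable.ite h1 measurable_const measurable_const).div_const _).sub
    ((Measurable.ite h2 measurable_const measurable_const).div_const _)

theorem exists_norm_covariance_le (X Y : Lattice d L × Spin) :
    ∃ K, ∀ a ∈ Set.Icc 0 β, ∀ b ∈ Set.Icc 0 β, ‖covariance t t' μ β X a Y b‖ ≤ K := by
  refine ⟨‖((kron X.2 Y.2 / (L : ℝ) ^ d : ℝ) : ℂ)‖ *
    ∑ m : Lattice d L, Real.exp (β * |dispersion t t' μ m|) * 1, fun a ha b hb => ?_⟩
  unfold covariance
  rw [norm_mul]
  refine mul_le_mul_of_nonneg_left (norm_sum_le_of_le _ fun m _ => ?_) (norm_nonneg _)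
  rw [norm_mul, mul_comm Complex.I, Complex.norm_exp_ofReal_mul_I, one_mul, Complex.norm_real,
    norm_mul]
  have h1 : ‖Real.exp (-(b - a) * dispersion t t' μ m)‖ ≤
      Real.exp (β * |dispersion t t' μ m|) := by
    rw [Real.norm_eq_abs, Real.abs_exp, Real.exp_le_exp]
    refine (le_abs_self _).trans ?_
    rw [abs_mul]
    refine mul_le_mul_of_nonneg_right ?_ (abs_nonneg _)
    rw [abs_le]
    constructor <;> linarith [ha.1, ha.2, hb.1, hb.2]
  have hfrac : ∀ r : ℝ, 0 ≤ 1 / (1 + Real.exp r) ∧ 1 / (1 + Real.exp r) ≤ 1 := by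
    intro r
    have := Real.exp_pos r
    refine ⟨by positivity, ?_⟩
    rw [div_le_one (by positivity)]
    linarith
  have h2 : ‖(if b - a ≤ 0 then (1 : ℝ) else 0) / (1 + Real.exp (β * dispersion t t' μ m)) -
      (if 0 < b - a then 1 else 0) / (1 + Real.exp (-β * dispersion t t' μ m))‖ ≤ 1 := by
    have h3 := hfrac (β * dispersion t t' μ m)
    have h4 := hfrac (-β * dispersion t t' μ m)
    rw [Real.norm_eq_abs, abs_le]
    by_cases h : b - a ≤ 0
    · rw [if_pos h, if_neg (not_lt.2 h), zero_div, sub_zero]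
      constructor <;> linarith
    · rw [if_neg h, if_pos (not_le.1 h), zero_div, zero_sub]
      constructor <;> linarith
  exact mul_le_mul h1 h2 (norm_nonneg _) (Real.exp_pos _).le

theorem integrableOn_covarianceDet {n : ℕ} (x y : Fin (2 * n) → Lattice d L)
    (σ : Fin (2 * n) → Spin) :
    IntegrableOn (fun s : Fin n → ℝ => covarianceDet t t' μ β x y σ s)
      (Set.Icc (0 : Fin n → ℝ) fun _ => β) := by
  choose K hK using fun i p => exists_norm_covariance_le t t' μ β (x i, σ i) (y p, σ p)
  have hentry : ∀ i p : Fin (2 * n), Measurable fun s : Fin n → ℝ =>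
      covariance t t' μ β (x i, σ i) (s (pairIdx i)) (y p, σ p) (s (pairIdx p)) := fun i p =>
    measurable_covariance t t' μ β _ _ (measurable_pi_apply (pairIdx i))
      (measurable_pi_apply (pairIdx p))
  have hdet : ∀ s : Fin n → ℝ, covarianceDet t t' μ β x y σ s =
      ∑ π : Equiv.Perm (Fin (2 * n)), ((Equiv.Perm.sign π : ℤ) : ℂ) * ∏ i,
        covariance t t' μ β (x (π i), σ (π i)) (s (pairIdx (π i))) (y i, σ i) (s (pairIdx i)) :=
    fun s => Matrix.det_apply' _
  have hmeas : Measurable fun s : Fin n → ℝ => covarianceDet t t' μ β x y σ s := by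
    rw [funext hdet]
    exact Finset.measurable_sum _ fun π _ => Measurable.const_mul
      (Finset.measurable_prod _ fun i _ => hentry (π i) i) _
  refine Measure.integrableOn_of_bounded isCompact_Icc.measure_lt_top.ne
    hmeas.aestronglyMeasurable (M := ∑ π : Equiv.Perm (Fin (2 * n)), ∏ i, K (π i) i) ?_
  refine (ae_restrict_iff' measurableSet_Icc).2 (Filter.Eventually.of_forall fun s hs => ?_)
  rw [hdet]
  refine norm_sum_le_of_le _ fun π _ => ?_
  have hsign : ‖((Equiv.Perm.sign π : ℤ) : ℂ)‖ = 1 := by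
    rcases Int.units_eq_one_or (Equiv.Perm.sign π) with h | h <;> simp [h]
  rw [norm_mul, hsign, one_mul, norm_prod]
  exact Finset.prod_le_prod (fun _ _ => norm_nonneg _) fun i _ =>
    hK _ _ _ ⟨hs.1 _, hs.2 _⟩ _ ⟨hs.1 _, hs.2 _⟩

end Covariance

/-! ### The indexing of pairs -/

section PairIndices

/-- The two indices of the `j`-th pair, `(j, c) ↦ 2j + c`. -/
def pairEquiv (n : ℕ) : Fin n × Fin 2 ≃ Fin (2 * n) where
  toFun p := ⟨2 * (p.1 : ℕ) + p.2, by omega⟩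
  invFun i := (pairIdx i, ⟨(i : ℕ) % 2, by omega⟩)
  left_inv p := by
    refine Prod.ext (Fin.ext ?_) (Fin.ext ?_)
    · simp [pairIdx]; omega
    · simp; omega
  right_inv i := Fin.ext (by simp [pairIdx]; omega)

theorem pairIdx_pairEquiv {n : ℕ} (j : Fin n) (c : Fin 2) : pairIdx (pairEquiv n (j, c)) = j :=
  congrArg Prod.fst ((pairEquiv n).symm_apply_apply (j, c))

theorem pairEquiv_zero {n : ℕ} (j : Fin n) : pairEquiv n (j, 0) = fstIdx j := rfl

theorem pairEquiv_one {n : ℕ} (j : Fin n) : pairEquiv n (j, 1) = sndIdx j := rfl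

/-- A function on `2n` indices, given by the `n` functions on the pairs. -/
def pairFun (n : ℕ) (α : Type*) : (Fin (2 * n) → α) ≃ (Fin n → Fin 2 → α) :=
  ((pairEquiv n).symm.arrowCongr (Equiv.refl α)).trans (Equiv.curry _ _ _)

theorem pairFun_apply {n : ℕ} {α : Type*} (x : Fin (2 * n) → α) (j : Fin n) (c : Fin 2) :
    pairFun n α x j c = x (pairEquiv n (j, c)) := by
  simp [pairFun, Equiv.arrowCongr, Equiv.curry]

/-- The permutation of the `2n` indices that permutes the pairs by `π`. -/
def pairPerm {n : ℕ} (π : Equiv.Perm (Fin n)) : Equiv.Perm (Fin (2 * n)) :=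
  ((pairEquiv n).symm.trans (π.prodCongr (Equiv.refl (Fin 2)))).trans (pairEquiv n)

theorem pairPerm_pairEquiv {n : ℕ} (π : Equiv.Perm (Fin n)) (j : Fin n) (c : Fin 2) :
    pairPerm π (pairEquiv n (j, c)) = pairEquiv n (π j, c) := by
  simp [pairPerm]

theorem pairIdx_pairPerm {n : ℕ} (π : Equiv.Perm (Fin n)) (i : Fin (2 * n)) :
    pairIdx (pairPerm π i) = π (pairIdx i) := by
  obtain ⟨⟨j, c⟩, rfl⟩ := (pairEquiv n).surjective i
  rw [pairPerm_pairEquiv, pairIdx_pairEquiv, pairIdx_pairEquiv]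

theorem ofFn_prod_pair {A : Type*} [Ring A] {n : ℕ} (f : Fin (2 * n) → A) :
    (List.ofFn f).prod = (List.ofFn fun j : Fin n => f (fstIdx j) * f (sndIdx j)).prod := by
  rw [List.ofFn_mul', List.prod_flatten, List.map_ofFn]
  congr 2
  funext j
  simp [List.ofFn_succ, fstIdx, sndIdx]

theorem ofFn_prod_sum_smul {A : Type*} [Ring A] [Algebra ℂ A] {n : ℕ} {Q : Type*} [Fintype Q]
    (c : Q → ℂ) (B : Fin n → Q → A) :
    (List.ofFn fun j => ∑ q, c q • B j q).prod =
      ∑ q : Fin n → Q, (∏ j, c (q j)) • (List.ofFn fun j => B j (q j)).prod := by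
  have h := (MultilinearMap.mkPiAlgebraFin ℂ n A).map_sum fun j q => c q • B j q
  simpa only [MultilinearMap.map_smul_univ, MultilinearMap.mkPiAlgebraFin_apply] using h

end PairIndices

/-! ### The perturbation series -/

section Series

variable {d L : ℕ} [NeZero L] (t t' μ β U : ℝ)
  (lam : Lattice d L → Lattice d L → Lattice d L → Lattice d L → ℝ)

/-- The coupling constant of a pair, including the constraint on the two spins. -/
def pairCoupling (q : (Fin 2 → Lattice d L) × (Fin 2 → Lattice d L) × (Fin 2 → Spin)) : ℝ :=
  kron (q.2.2 0) Spin.up * kron (q.2.2 1) Spin.down *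
    coupling U lam (q.1 0) (q.1 1) (q.2.1 0) (q.2.1 1)

/-- The interaction in terms of the even elements `ψ_X^* ψ_Y`. No anti-commutator arises,
because `ψ_{y↓}^*` and `ψ_{z↑}` carry different spins. -/
theorem interaction_eq_sum : interaction U lam =
    ∑ q : (Fin 2 → Lattice d L) × (Fin 2 → Lattice d L) × (Fin 2 → Spin),
      ((pairCoupling U lam q : ℝ) : ℂ) •
        (create (q.1 0, q.2.2 0) * annihilate (q.2.1 0, q.2.2 0) *
          (create (q.1 1, q.2.2 1) * annihilate (q.2.1 1, q.2.2 1))) := by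
  have hop : ∀ x y z w : Lattice d L,
      create (x, Spin.up) * create (y, Spin.down) * annihilate (w, Spin.down) *
        annihilate (z, Spin.up) =
      create (x, Spin.up) * annihilate (z, Spin.up) *
        (create (y, Spin.down) * annihilate (w, Spin.down)) := by
    intro x y z w
    have h1 := annihilate_annihilate_anticomm (w, Spin.down) (z, Spin.up)
    have h2 := annihilate_create_anticomm (z, Spin.up) (y, Spin.down)
    rw [if_neg (by simp), zero_smul] at h2
    rw [mul_assoc, eq_neg_of_add_eq_zero_left h1, mul_assoc, mul_assoc,
      ← mul_assoc (annihilate (z, Spin.up)), eq_neg_of_add_eq_zero_left h2]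
    noncomm_ring
  have hsum : ∀ (α : Type) [Fintype α] (g : α → α → Op (Lattice d L × Spin)),
      ∑ x : Fin 2 → α, g (x 0) (x 1) = ∑ a, ∑ b, g a b := by
    intro α _ g
    rw [← (finTwoArrowEquiv α).symm.sum_comp, Fintype.sum_prod_type]
    rfl
  have hspin : ∀ g : Spin → Spin → Op (Lattice d L × Spin),
      ∑ a, ∑ b, ((kron a Spin.up * kron b Spin.down : ℝ) : ℂ) • g a b =
        g Spin.up Spin.down := by
    intro g
    rw [Finset.sum_eq_single Spin.up, Finset.sum_eq_single Spin.down]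
    · simp [kron]
    · intro b _ hb; simp [kron, hb]
    · simp
    · intro a _ ha; simp [kron, ha]
    · simp
  rw [Fintype.sum_prod_type]
  simp only [Fintype.sum_prod_type, pairCoupling]
  rw [hsum (Lattice d L) fun a b => ∑ y : Fin 2 → Lattice d L, ∑ σ : Fin 2 → Spin,
    ((kron (σ 0) Spin.up * kron (σ 1) Spin.down * coupling U lam a b (y 0) (y 1) : ℝ) : ℂ) •
      (create (a, σ 0) * annihilate (y 0, σ 0) * (create (b, σ 1) * annihilate (y 1, σ 1)))]
  refine Finset.sum_congr rfl fun x _ => Finset.sum_congr rfl fun y _ => ?_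
  rw [hsum (Lattice d L) fun a b => ∑ σ : Fin 2 → Spin,
    ((kron (σ 0) Spin.up * kron (σ 1) Spin.down * coupling U lam x y a b : ℝ) : ℂ) •
      (create (x, σ 0) * annihilate (a, σ 0) * (create (y, σ 1) * annihilate (b, σ 1)))]
  refine Finset.sum_congr rfl fun z _ => Finset.sum_congr rfl fun w _ => ?_
  rw [hsum Spin fun a b =>
    ((kron a Spin.up * kron b Spin.down * coupling U lam x y z w : ℝ) : ℂ) •
      (create (x, a) * annihilate (z, a) * (create (y, b) * annihilate (w, b)))]
  simp only [Complex.ofReal_mul _ (coupling U lam x y z w), mul_smul]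
  rw [hspin fun a b => ((coupling U lam x y z w : ℝ) : ℂ) •
      (create (x, a) * annihilate (z, a) * (create (y, b) * annihilate (w, b))), hop]

/-- The integrand of the `n`-th order of the perturbation series, up to the sign. -/
noncomputable def seriesDensity (n : ℕ) (s : Fin n → ℝ) : ℂ :=
  ∑ x : Fin (2 * n) → Lattice d L, ∑ y : Fin (2 * n) → Lattice d L, ∑ σ : Fin (2 * n) → Spin,
    ((∏ j : Fin n, (kron (σ (fstIdx j)) Spin.up * kron (σ (sndIdx j)) Spin.down *
      coupling U lam (x (fstIdx j)) (x (sndIdx j)) (y (fstIdx j)) (y (sndIdx j))) : ℝ) : ℂ) *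
        covarianceDet t t' μ β x y σ s

/-- A permutation of the times is undone by a permutation of the pairs of summation variables,
which permutes rows and columns of the determinant simultaneously. -/
theorem seriesDensity_comp_perm (n : ℕ) (π : Equiv.Perm (Fin n)) (s : Fin n → ℝ) :
    seriesDensity t t' μ β U lam n (s ∘ π) = seriesDensity t t' μ β U lam n s := by
  have hdet : ∀ (x y : Fin (2 * n) → Lattice d L) (σ : Fin (2 * n) → Spin),
      covarianceDet t t' μ β (x ∘ pairPerm π) (y ∘ pairPerm π) (σ ∘ pairPerm π) (s ∘ π) =
        covarianceDet t t' μ β x y σ s := by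
    intro x y σ
    unfold covarianceDet
    rw [← Matrix.det_submatrix_equiv_self (pairPerm π) (Matrix.of fun j k : Fin (2 * n) =>
      covariance t t' μ β (x j, σ j) (s (pairIdx j)) (y k, σ k) (s (pairIdx k)))]
    congr 1
    ext i k
    simp [pairIdx_pairPerm]
  have hfst : ∀ j, pairPerm π (fstIdx j) = fstIdx (π j) := fun j => pairPerm_pairEquiv π j 0
  have hsnd : ∀ j, pairPerm π (sndIdx j) = sndIdx (π j) := fun j => pairPerm_pairEquiv π j 1
  have hcomp : ∀ (α : Type) (x : Fin (2 * n) → α),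
      ((pairPerm π).symm.arrowCongr (Equiv.refl α)) x = x ∘ pairPerm π := fun α x => rfl
  unfold seriesDensity
  refine (Fintype.sum_equiv ((pairPerm π).symm.arrowCongr (Equiv.refl _)) _ _ fun x => ?_).symm
  refine Fintype.sum_equiv ((pairPerm π).symm.arrowCongr (Equiv.refl _)) _ _ fun y => ?_
  refine Fintype.sum_equiv ((pairPerm π).symm.arrowCongr (Equiv.refl _)) _ _ fun σ => ?_
  rw [hcomp, hcomp, hcomp, hdet]
  congr 2
  refine (Fintype.prod_equiv π _ _ fun j => ?_).symm
  simp only [Function.comp, hfst, hsnd]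

/-- At decreasing times the integrand is the free expectation of the product of the
interactions. -/
theorem freeExp_ofFn_prod_interaction {n : ℕ} {s : Fin n → ℝ} (hs : StrictAnti s) :
    freeExp t t' μ β (List.ofFn fun j =>
      heisenberg (freeHamiltonian d L t t' μ) (interaction U lam) (s j)).prod =
      seriesDensity t t' μ β U lam n s := by
  have hheis : ∀ r : ℝ, heisenberg (freeHamiltonian d L t t' μ) (interaction U lam) r =
      ∑ q : (Fin 2 → Lattice d L) × (Fin 2 → Lattice d L) × (Fin 2 → Spin),
      ((pairCoupling U lam q : ℝ) : ℂ) •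
        (createAt t t' μ (q.1 0, q.2.2 0) r * annihilateAt t t' μ (q.2.1 0, q.2.2 0) r *
          (createAt t t' μ (q.1 1, q.2.2 1) r * annihilateAt t t' μ (q.2.1 1, q.2.2 1) r)) := by
    intro r
    rw [interaction_eq_sum, heisenberg_sum]
    simp only [heisenberg_smul, heisenberg_mul]
    rfl
  simp only [hheis]
  rw [ofFn_prod_sum_smul, map_sum]
  -- a family of pairs of data is a datum for each of the `2n` indices
  let e : ((Fin (2 * n) → Lattice d L) × (Fin (2 * n) → Lattice d L) × (Fin (2 * n) → Spin)) ≃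
      (Fin n → (Fin 2 → Lattice d L) × (Fin 2 → Lattice d L) × (Fin 2 → Spin)) :=
    ((pairFun n _).prodCongr (((pairFun n _).prodCongr (pairFun n _)).trans
      (Equiv.arrowProdEquivProdArrow _ _ _).symm)).trans
        (Equiv.arrowProdEquivProdArrow _ _ _).symm
  rw [← e.sum_comp, Fintype.sum_prod_type]
  simp only [Fintype.sum_prod_type]
  unfold seriesDensity
  refine Finset.sum_congr rfl fun x _ => Finset.sum_congr rfl fun y _ =>
    Finset.sum_congr rfl fun σ _ => ?_
  have h1 : ∀ j, (e (x, y, σ) j).1 = pairFun n _ x j := fun _ => rfl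
  have h2 : ∀ j, (e (x, y, σ) j).2.1 = pairFun n _ y j := fun _ => rfl
  have h3 : ∀ j, (e (x, y, σ) j).2.2 = pairFun n _ σ j := fun _ => rfl
  simp only [pairCoupling, h1, h2, h3, pairFun_apply, pairEquiv_zero, pairEquiv_one]
  rw [map_smul, smul_eq_mul]
  push_cast
  by_cases hσ : ∀ j : Fin n, σ (fstIdx j) ≠ σ (sndIdx j)
  · congr 1
    rw [← freeExp_ofFn_prod_eq_covarianceDet t t' μ β x y σ hσ hs, ofFn_prod_pair]
    have hf : ∀ j : Fin n, pairIdx (fstIdx j) = j := fun j => pairIdx_pairEquiv j 0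
    have hg : ∀ j : Fin n, pairIdx (sndIdx j) = j := fun j => pairIdx_pairEquiv j 1
    simp only [hf, hg]
  -- equal spins violate the constraints in the coupling constant
  · push Not at hσ
    obtain ⟨j, hj⟩ := hσ
    have h0 : (∏ j : Fin n, ((kron (σ (fstIdx j)) Spin.up : ℝ) : ℂ) *
        ((kron (σ (sndIdx j)) Spin.down : ℝ) : ℂ) *
        ((coupling U lam (x (fstIdx j)) (x (sndIdx j)) (y (fstIdx j)) (y (sndIdx j)) : ℝ) : ℂ))
        = 0 := by
      refine Finset.prod_eq_zero (Finset.mem_univ j) ?_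
      rw [hj]
      cases h : σ (sndIdx j) <;> simp [kron]
    rw [h0, zero_mul, zero_mul]

theorem integrableOn_seriesDensity (n : ℕ) :
    IntegrableOn (seriesDensity t t' μ β U lam n) (Set.Icc (0 : Fin n → ℝ) fun _ => β) := by
  unfold seriesDensity
  refine integrable_finsetSum _ fun x _ => integrable_finsetSum _ fun y _ =>
    integrable_finsetSum _ fun σ _ => ?_
  exact (integrableOn_covarianceDet t t' μ β x y σ).integrable.const_mul _

theorem seriesTerm_eq (n : ℕ) : seriesTerm t t' μ β U lam n =
    (1 / (n.factorial : ℂ)) * ((-1) ^ n * ∫ s in Set.Icc (0 : Fin n → ℝ) (fun _ => β),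
      seriesDensity t t' μ β U lam n s) := by
  have hint := fun (x y : Fin (2 * n) → Lattice d L) σ =>
    (integrableOn_covarianceDet t t' μ β (n := n) x y σ).integrable
  have h : ∫ s in Set.Icc (0 : Fin n → ℝ) (fun _ => β), seriesDensity t t' μ β U lam n s =
      ∑ x : Fin (2 * n) → Lattice d L, ∑ y : Fin (2 * n) → Lattice d L,
      ∑ σ : Fin (2 * n) → Spin, ((∏ j : Fin n, (kron (σ (fstIdx j)) Spin.up *
        kron (σ (sndIdx j)) Spin.down * coupling U lam (x (fstIdx j)) (x (sndIdx j))
          (y (fstIdx j)) (y (sndIdx j))) : ℝ) : ℂ) *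
        ∫ s in Set.Icc (0 : Fin n → ℝ) (fun _ => β), covarianceDet t t' μ β x y σ s := by
    unfold seriesDensity
    rw [integral_finsetSum _ fun x _ => integrable_finsetSum _ fun y _ =>
      integrable_finsetSum _ fun σ _ => (hint x y σ).const_mul _]
    refine Finset.sum_congr rfl fun x _ => ?_
    rw [integral_finsetSum _ fun y _ =>
      integrable_finsetSum _ fun σ _ => (hint x y σ).const_mul _]
    refine Finset.sum_congr rfl fun y _ => ?_
    rw [integral_finsetSum _ fun σ _ => (hint x y σ).const_mul _]
    exact Finset.sum_congr rfl fun σ _ => integral_const_mul _ _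
  unfold seriesTerm
  rw [h, Finset.mul_sum (a := (-1 : ℂ) ^ n)]
  congr 1
  refine Finset.sum_congr rfl fun x _ => ?_
  rw [Finset.mul_sum]
  refine Finset.sum_congr rfl fun y _ => ?_
  rw [Finset.mul_sum]
  refine Finset.sum_congr rfl fun σ _ => ?_
  rw [Finset.prod_neg, ← mul_assoc]
  simp

/-- The `n`-th term of the perturbation series is the free expectation of the `n`-th term of the
Dyson series. -/
theorem seriesTerm_eq_freeExp (n : ℕ) : seriesTerm t t' μ β U lam n =
    freeExp t t' μ β ((-1 : ℝ) ^ n • ∫ s in orderedSimplex n β, (List.ofFn fun j =>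
      heisenberg (freeHamiltonian d L t t' μ) (interaction U lam) (s j)).prod) := by
  have hfac : (n.factorial : ℂ) ≠ 0 := by exact_mod_cast n.factorial_ne_zero
  have hcomm := (LinearMap.toContinuousLinearMap
    (freeExp (d := d) (L := L) t t' μ β)).integral_comp_comm
    (integrableOn_ofFn_prod (continuous_heisenberg (freeHamiltonian d L t t' μ)
      (interaction U lam)) n β)
  rw [seriesTerm_eq, setIntegral_Icc_eq_factorial_mul
    (integrableOn_seriesDensity t t' μ β U lam n) (seriesDensity_comp_perm t t' μ β U lam n)]
  have h1 : ∫ s in orderedSimplex n β, seriesDensity t t' μ β U lam n s =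
      freeExp t t' μ β (∫ s in orderedSimplex n β, (List.ofFn fun j =>
        heisenberg (freeHamiltonian d L t t' μ) (interaction U lam) (s j)).prod) := by
    refine Eq.trans ?_ hcomm
    exact setIntegral_congr_fun (measurableSet_orderedSimplex n β) fun s hs =>
      (freeExp_ofFn_prod_interaction t t' μ β U lam hs.1).symm
  rw [h1, ← Complex.coe_smul, map_smul, smul_eq_mul]
  push_cast
  field_simp

/-- The free expectation of the Dyson series, with `e^{-βH₀} (e^{βH₀} e^{-βH_λ}) = e^{-βH_λ}` on the
left-hand side. -/
theorem hasSum_seriesTerm (hβ : 0 < β) : HasSum (seriesTerm t t' μ β U lam)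
    (Tr (NormedSpace.exp (-(β • hamiltonian t t' μ U lam))) /
      Tr (NormedSpace.exp (-(β • freeHamiltonian d L t t' μ)))) := by
  have h := (LinearMap.toContinuousLinearMap (freeExp (d := d) (L := L) t t' μ β)).hasSum
    (hasSum_dyson (freeHamiltonian d L t t' μ) (interaction U lam) hβ.le)
  have h1 : freeExp t t' μ β (NormedSpace.exp (β • freeHamiltonian d L t t' μ) *
      NormedSpace.exp (-(β • (freeHamiltonian d L t t' μ + interaction U lam)))) =
      Tr (NormedSpace.exp (-(β • hamiltonian t t' μ U lam))) /
      Tr (NormedSpace.exp (-(β • freeHamiltonian d L t t' μ))) := by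
    rw [freeExp, thermal_apply, ← mul_assoc, exp_neg_mul_exp, one_mul, hamiltonian]
  rw [← h1]
  exact h.congr_fun (seriesTerm_eq_freeExp t t' μ β U lam)

theorem seriesTerm_zero : seriesTerm t t' μ β U lam 0 = 1 := by
  simp [seriesTerm, covarianceDet, Measure.real, Real.volume_Icc_pi]

end Series

end Hubbard

theorem proposition2p3 (d L : ℕ) [NeZero L] (hd : 1 ≤ d) (t t' μ β : ℝ) (hβ : 0 < β) (U : ℝ)
    (lam : Hubbard.Lattice d L → Hubbard.Lattice d L → Hubbard.Lattice d L →
      Hubbard.Lattice d L → ℝ) :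
    Hubbard.Tr (NormedSpace.exp (-(β : ℂ) • Hubbard.freeHamiltonian d L t t' μ)) ≠ 0 ∧
    (∀ (n : ℕ) (x y : Fin (2 * n) → Hubbard.Lattice d L) (σ : Fin (2 * n) → Hubbard.Spin),
      IntegrableOn (fun s : Fin n → ℝ => Hubbard.covarianceDet t t' μ β x y σ s)
        (Set.Icc (0 : Fin n → ℝ) (fun _ => β)) volume) ∧
    Summable (fun n : ℕ => Hubbard.seriesTerm t t' μ β U lam (n + 1)) ∧
    Hubbard.Tr (NormedSpace.exp (-(β : ℂ) • Hubbard.hamiltonian t t' μ U lam)) /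
        Hubbard.Tr (NormedSpace.exp (-(β : ℂ) • Hubbard.freeHamiltonian d L t t' μ)) =
      1 + ∑' n : ℕ, Hubbard.seriesTerm t t' μ β U lam (n + 1) := by
  have hexp : ∀ H : Hubbard.Op (Hubbard.Lattice d L × Hubbard.Spin),
      -(β : ℂ) • H = -(β • H) := fun H => by rw [neg_smul, Complex.coe_smul]
  have hsum := Hubbard.hasSum_seriesTerm t t' μ β U lam hβ
  simp only [hexp]
  refine ⟨Hubbard.Tr_exp_neg_ne_zero (Hubbard.star_freeHamiltonian t t' μ) β,
    fun n x y σ => Hubbard.integrableOn_covarianceDet t t' μ β x y σ,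
    (summable_nat_add_iff 1).2 hsum.summable, ?_⟩
  rw [← hsum.tsum_eq, hsum.summable.tsum_eq_zero_add, Hubbard.seriesTerm_zero]
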